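/- Let $p>q$ be prime numbers, let $e$ be the order of $p$ modulo $q$, let $g\ge 1$ be an integer and $n=qg+1$, and assume $p^e>n$ and $p\ge n+q-2$. Let $m\ge 1$, let $\mathbb Q_p^{(m)}$ be the unramified extension of $\mathbb Q_p$ of degree $m$ (with the norm $|\cdot|_p$ extending the $p$-adic norm) and $\mathbb Z_p^{(m)}$ its ring of integers. For $z=(z_1,\dots,z_n)$ and $s\ge 1$ put $$\Phi_s(t,z)=\big((t-z_1)\cdots(t-z_n)\big)^{(p^{es}-1)/q},$$ let $A(\Phi_s)=\big(\mathrm{Coeff}_{t^{p^{es}v-u}}\Phi_s\big)_{u,v=1,\dots,g}$, and let $I_s(z)$ be the $n\times g$ matrix whose entry in row $i$ and column $\ell$ is the coefficient of $t^{\ell p^{es}-1}$ in $\Phi_s(t,z)/(t-z_i)$. Let $$\mathfrak D=\mathfrak D^{(m)}_{\rm KZ}=\{a\in(\mathbb Z_p^{(m)})^n : |\det A(\Phi_1(t,a))|_p=1\},\qquad \mathfrak D^{o}=\{a\in\mathfrak D : a_i\ne a_j \text{ for } i\neq j\}.$$ Let $W=\{I\in(\mathbb Q_p^{(m)})^n :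 I_1+\dots+I_n=0\}$, let $\Omega_{ij}$ ($i\ne j$) be the $n\times n$ matrix with entries $-1$ at $(i,i)$ and $(j,j)$, $1$ at $(i,j)$ and $(j,i)$, and $0$ elsewhere, and let $$H_i(z)=\frac1q\sum_{j\ne i}\frac{\Omega_{ij}}{z_i-z_j},\qquad \nabla_i^{\rm KZ}=\frac{\partial}{\partial z_i}-H_i(z),\qquad i=1,\dots,n.$$ "Analytic" means locally given by convergent power series over $\mathbb Q_p^{(m)}$. Then: 1. For $s\ge1$ and $a\in\mathfrak D$ one has $|\det A(\Phi_s(t,a))|_p=1$, and the matrices $I_s(a)\,A(\Phi_s(t,a))^{-1}$ converge as $s\to\infty$, uniformly on $\mathfrak D$, to an analytic $n\times g$ matrix $\mathcal I(a)$. 2. Let $\mathcal L_a$ be the span of the columns of $\mathcal I(a)$. Then $\mathcal L_a\subset W$ for $a\in\mathfrak D$, and $\dim W=qg$. 3. (Invariance over $\mathfrak D$.) Let $U\subset\mathfrak D$ be open and let $s=\mathcal I\cdot c$ on $U$ with $c=(c_1,\dots,c_g)$ analytic on $U$. Then for every $i$ there is an analytic $c'=(c_1',\dots,c_g')$ on $U$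 with $\nabla^{\rm KZ}_i s=\mathcal I\cdot c'$ on $U\cap\mathfrak D^{o}$. 4. (Invariance over $\mathfrak D^{o}$.) Let $U\subset\mathfrak D^{o}$ be open and let $s$ be analytic on $U$ with $s(z)\in\mathcal L_z$ for all $z\in U$. Then for every $i$, $\nabla_i^{\rm KZ}s$ is analytic on $U$ and $(\nabla_i^{\rm KZ}s)(z)\in\mathcal L_z$ for all $z\in U$. 5. Let $d_\Phi$ be the degree of the polynomial $\det A(\Phi_1)\in\mathbb Z[z]$ and $d_M$ the degree of the $g\times g$ minor of $I_1(z)$ in the rows $q(g-\ell)+1$, $\ell=1,\dots,g$. If $p^m>d_\Phi+d_M$, then $\dim\mathcal L_a=g$ for all $a\in\mathfrak D^{o}$. -/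

import Mathlib

open Filter Topology

noncomputable section

namespace PadicKZ

/-- The unramified extension of degree `m` of `ℚ_p` inside the algebraic closure `PadicAlgCl p`,
obtained by adjoining the roots of unity of order dividing `p ^ m - 1`. -/
def unramified (p : ℕ) [Fact p.Prime] (m : ℕ) : IntermediateField ℚ_[p] (PadicAlgCl p) :=
  IntermediateField.adjoin ℚ_[p] {ζ : PadicAlgCl p | ζ ^ (p ^ m - 1) = 1}

/-- The field `ℚ_p^{(m)}`, with the norm induced from `PadicAlgCl p`, which extends the `p`-adic
norm of `ℚ_p`. -/
def Qpm (p : ℕ) [Fact p.Prime] (m : ℕ) : Type := unramified p m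

instance (p : ℕ) [Fact p.Prime] (m : ℕ) : NontriviallyNormedField (Qpm p m) :=
  inferInstanceAs (NontriviallyNormedField (unramified p m))

section Polynomials

/-- The order `e` of `p` modulo `q`. -/
def ord (p q : ℕ) : ℕ := orderOf (p : ZMod q)

/-- The master polynomial `Φ_s(t, z) = ((t - z_1) ⋯ (t - z_n)) ^ ((p ^ (e s) - 1) / q)`,
with `n = q g + 1`, as a polynomial in `t` over `ℤ[z_1, …, z_n]`. -/
def masterPoly (p q g s : ℕ) : Polynomial (MvPolynomial (Fin (q * g + 1)) ℤ) :=
  (∏ j, (Polynomial.X - Polynomial.C (MvPolynomial.X j))) ^ ((p ^ (ord p q * s) - 1) / q)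

/-- The Hasse--Witt matrix `A(Φ_s)`: its `(u, v)` entry, `u, v = 1, …, g`, is the coefficient of
`t ^ (p ^ (e s) v - u)` in `Φ_s(t, z)`. The indices in `Fin g` start at `0`, hence the shifts. -/
def hasseWitt (p q g s : ℕ) : Matrix (Fin g) (Fin g) (MvPolynomial (Fin (q * g + 1)) ℤ) :=
  Matrix.of fun u v =>
    (masterPoly p q g s).coeff (p ^ (ord p q * s) * ((v : ℕ) + 1) - ((u : ℕ) + 1))

/-- The `n × g` matrix `I_s(z)` of `p ^ (e s)`-hypergeometric solutions: its entry in row `i` and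
column `ℓ = 1, …, g` is the coefficient of `t ^ (ℓ p ^ (e s) - 1)` in `Φ_s(t, z) / (t - z_i)`
(the division is exact for `s ≥ 1`). -/
def hypSol (p q g s : ℕ) : Matrix (Fin (q * g + 1)) (Fin g) (MvPolynomial (Fin (q * g + 1)) ℤ) :=
  Matrix.of fun i l =>
    (masterPoly p q g s /ₘ (Polynomial.X - Polynomial.C (MvPolynomial.X i))).coeff
      (((l : ℕ) + 1) * p ^ (ord p q * s) - 1)

/-- The degree `d_Φ` of the polynomial `det A(Φ_1)`. -/
def dPhi (p q g : ℕ) : ℕ := (hasseWitt p q g 1).det.totalDegree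

/-- The row with index `q (g - ℓ) + 1` (counted from `1`), for `ℓ = 1, …, g`. -/
def minorRow (q g : ℕ) (l : Fin g) : Fin (q * g + 1) :=
  ⟨q * (g - ((l : ℕ) + 1)), Nat.lt_succ_of_le (Nat.mul_le_mul_left q (Nat.sub_le _ _))⟩

/-- The degree `d_M` of the `g × g` minor `M(z)` of `I_1(z)` in the rows `q (g - ℓ) + 1`. -/
def dM (p q g : ℕ) : ℕ := ((hypSol p q g 1).submatrix (minorRow q g) id).det.totalDegree

end Polynomials

section Analysis

variable (K : Type*) [NontriviallyNormedField K]

/-- The value `A(Φ_s(t, a))` of the Hasse--Witt matrix at a point `a`. -/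
def hasseWittAt (p q g s : ℕ) (a : Fin (q * g + 1) → K) : Matrix (Fin g) (Fin g) K :=
  (hasseWitt p q g s).map (MvPolynomial.aeval a)

/-- The value `I_s(a)` of the matrix of `p ^ (e s)`-hypergeometric solutions at a point `a`. -/
def hypSolAt (p q g s : ℕ) (a : Fin (q * g + 1) → K) : Matrix (Fin (q * g + 1)) (Fin g) K :=
  (hypSol p q g s).map (MvPolynomial.aeval a)

/-- The matrices `I_s(a) A(Φ_s(t, a))⁻¹` whose limit is `𝓘(a)`. -/
def approxFrame (p q g s : ℕ) (a : Fin (q * g + 1) → K) : Matrix (Fin (q * g + 1)) (Fin g) K :=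
  hypSolAt K p q g s a * (hasseWittAt K p q g s a)⁻¹

/-- The matrix `𝓘(a) = lim_{s → ∞} I_s(a) A(Φ_s(t, a))⁻¹`. -/
def frame (p q g : ℕ) (a : Fin (q * g + 1) → K) : Matrix (Fin (q * g + 1)) (Fin g) K :=
  Matrix.of fun i l => limUnder atTop fun s : ℕ => approxFrame K p q g s a i l

/-- The domain `𝔇_KZ`: the integral points `a` with `|det A(Φ_1(t, a))| = 1`. -/
def domainKZ (p q g : ℕ) : Set (Fin (q * g + 1) → K) :=
  {a | (∀ i, ‖a i‖ ≤ 1) ∧ ‖(hasseWittAt K p q g 1 a).det‖ = 1}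

/-- The domain `𝔇_KZ^o`: the points of `𝔇_KZ` with pairwise distinct coordinates. -/
def domainKZo (p q g : ℕ) : Set (Fin (q * g + 1) → K) :=
  {a | a ∈ domainKZ K p q g ∧ ∀ i j, i ≠ j → a i ≠ a j}

/-- The fiber `W = {I : I_1 + ⋯ + I_n = 0}` of the KZ bundle. -/
def fiberW (n : ℕ) : Submodule K (Fin n → K) where
  carrier := {I | ∑ i, I i = 0}
  add_mem' := by
    intro a b ha hb
    simp only [Set.mem_ofPred_eq, Pi.add_apply, Finset.sum_add_distrib] at *
    rw [ha, hb, add_zero]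
  zero_mem' := by simp
  smul_mem' := by
    intro c a ha
    simp only [Set.mem_ofPred_eq, Pi.smul_apply, ← Finset.smul_sum] at *
    rw [ha, smul_zero]

/-- The fiber `𝓛_a`, spanned by the columns of `𝓘(a)`. -/
def fiberL (p q g : ℕ) (a : Fin (q * g + 1) → K) : Submodule K (Fin (q * g + 1) → K) :=
  Submodule.span K (Set.range fun l : Fin g => fun i => frame K p q g a i l)

/-- The matrix `Ω_{ij}` (for `i ≠ j`): `-1` at `(i, i)` and `(j, j)`, `1` at `(i, j)` and `(j, i)`,
and zero elsewhere. -/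
def Omega {n : ℕ} (i j : Fin n) : Matrix (Fin n) (Fin n) K :=
  Matrix.single i j 1 + Matrix.single j i 1 - Matrix.single i i 1 - Matrix.single j j 1

variable {K}

/-- The Gaudin Hamiltonian `H_i(z) = (1 / q) ∑_{j ≠ i} Ω_{ij} / (z_i - z_j)`
(meaningful where the coordinates of `z` are pairwise distinct). -/
def gaudin (q : ℕ) {n : ℕ} (i : Fin n) (z : Fin n → K) : Matrix (Fin n) (Fin n) K :=
  (q : K)⁻¹ • ∑ j ∈ Finset.univ.erase i, (z i - z j)⁻¹ • Omega K i j

/-- The KZ connection `∇_i^KZ s = ∂s/∂z_i - H_i s`. -/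
def nablaKZ (q : ℕ) {n : ℕ} (i : Fin n) (s : (Fin n → K) → (Fin n → K)) (z : Fin n → K) :
    Fin n → K :=
  fderiv K s z (Pi.single i 1) - (gaudin q i z).mulVec (s z)

/-- Sections over `U` that are combinations `∑_l c_l(z) 𝓘_l(z)` of the columns of `𝓘` with
coefficients analytic on `U`. -/
def IsFrameSection (p q g : ℕ) (U : Set (Fin (q * g + 1) → K))
    (s : (Fin (q * g + 1) → K) → (Fin (q * g + 1) → K)) : Prop :=
  ∃ c : (Fin (q * g + 1) → K) → (Fin g → K), AnalyticOnNhd K c U ∧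
    ∀ z ∈ U, s z = (frame K p q g z).mulVec (c z)

/-- Analytic maps on `U` whose value at every `z ∈ U` lies in `𝓛_z`. -/
def IsFiberSection (p q g : ℕ) (U : Set (Fin (q * g + 1) → K))
    (s : (Fin (q * g + 1) → K) → (Fin (q * g + 1) → K)) : Prop :=
  AnalyticOnNhd K s U ∧ ∀ z ∈ U, s z ∈ fiberL K p q g z

end Analysis

end PadicKZ

end

/-!
Put `P = p ^ e`, `F = (t - z_1) ⋯ (t - z_n)`, `Φ_s = F ^ ((P ^ s - 1) / q)`, and attach to a
polynomial `k` the row of the coefficients of `t ^ (l P ^ s - 1)` in `k Φ_s / F`, multiplied by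
`A(Φ_s)⁻¹`. The polynomials `k = F / (t - z_i)` give the rows of `I_s A(Φ_s)⁻¹`.

Since the powers of a polynomial over `ℤ[z]` decompose like ghost components of Witt vectors, these
normalized rows satisfy Dwork congruences: the rows of levels `s ≥ r` agree modulo `p ^ r` over
every local ring in which `p` is a nonunit and `det A(Φ_1)` is a unit. Over the ring of integers
this is uniform convergence; over power series with integral coefficients, at the point `a + X`, it
is convergence of the Taylor expansions, hence analyticity and convergence of the derivatives. So
the differentiation formulas for the rows pass to the limit, with `(P ^ s - 1) / q` replaced by
`-1 / q`.

Exact forms have rows divisible by `P ^ s`, so they vanish in the limit. For pairwise distinct `z_i`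
every polynomial is, modulo exact forms, a combination of the `F / (t - z_i)`, while
the rows of `t ^ u F`, `u < g`, are the standard basis vectors; hence `𝓘(a)` has a left inverse.
-/

noncomputable section

namespace PadicKZ

section Exponents

/-- The exponent `(P ^ s - 1) / q` of the master polynomial, where `P = p ^ e`. -/
def expo (P q s : ℕ) : ℕ := (P ^ s - 1) / q

theorem mul_expo {P q : ℕ} (hq : q ∣ P - 1) (s : ℕ) : q * expo P q s = P ^ s - 1 :=
  Nat.mul_div_cancel' (hq.trans (by simpa using Nat.sub_dvd_pow_sub_pow P 1 s))

theorem pos_of_dvd_sub_one {P q : ℕ} (hP : 1 < P) (hq : q ∣ P - 1) : 0 < q :=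
  Nat.pos_of_dvd_of_pos hq (Nat.sub_pos_of_lt hP)

theorem expo_pos {P q : ℕ} (hP : 1 < P) (hq : q ∣ P - 1) {s : ℕ} (hs : 1 ≤ s) :
    0 < expo P q s := by
  have hpow : 1 < P ^ s := Nat.one_lt_pow (by omega) hP
  have hpos : 0 < q * expo P q s := by
    rw [mul_expo hq]
    omega
  exact Nat.pos_of_mul_pos_left hpos

theorem expo_add {P q : ℕ} (hP : 1 < P) (hq : q ∣ P - 1) (i j : ℕ) :
    expo P q (i + j) = expo P q i + P ^ i * expo P q j := by
  apply Nat.eq_of_mul_eq_mul_left (pos_of_dvd_sub_one hP hq)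
  have hi : 0 < P ^ i := by positivity
  have hij : P ^ i ≤ P ^ i * P ^ j := Nat.le_mul_of_pos_right _ (by positivity)
  rw [mul_add, mul_left_comm, mul_expo hq, mul_expo hq, mul_expo hq, pow_add, Nat.mul_sub]
  omega

theorem expo_add_sub_one {P q : ℕ} (hP : 1 < P) (hq : q ∣ P - 1) {i : ℕ} (hi : 1 ≤ i) (j : ℕ) :
    expo P q (i + j) - 1 = expo P q i - 1 + expo P q j * P ^ i := by
  have := expo_pos hP hq hi
  rw [expo_add hP hq, mul_comm]
  omega

end Exponents

section Rows

open Polynomial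
open scoped Matrix

variable {R : Type*} [CommRing R]

/-- The row vector of the coefficients of `t ^ (l P ^ s - 1)`, `l = 1, …, g`, in
`k F ^ (expo P q s - 1)`, as a linear map in the polynomial `k`. With
`F = (t - z_1) ⋯ (t - z_n)`, the choice `k = F / (t - z_i)` gives the `i`-th row of `I_s(z)`. -/
def row (F : R[X]) (P q g s : ℕ) : R[X] →ₗ[R] Fin g → R :=
  LinearMap.pi fun l => lcoeff R (((l : ℕ) + 1) * P ^ s - 1) ∘ₗ
    LinearMap.mulRight R (F ^ (expo P q s - 1))

/-- The Hasse-Witt matrix of `F ^ (expo P q s)`. -/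
def hwMatrix (F : R[X]) (P q g s : ℕ) : Matrix (Fin g) (Fin g) R :=
  Matrix.of fun u => row F P q g s (X ^ (u : ℕ) * F)

/-- The row vector `row F P q g s k` multiplied by the inverse of the Hasse-Witt matrix. With
`F = (t - z_1) ⋯ (t - z_n)` and `k = F / (t - z_i)` it is the `i`-th row of `I_s A(Φ_s)⁻¹`. -/
def nrow (F : R[X]) (P q g s : ℕ) : R[X] →ₗ[R] Fin g → R :=
  (hwMatrix F P q g s)⁻¹.vecMulLinear ∘ₗ row F P q g s

/-- The combination `∑ c_u t ^ u F` of the polynomials whose rows form the Hasse-Witt matrix. -/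
def comb (F : R[X]) (g : ℕ) : (Fin g → R) →ₗ[R] R[X] :=
  Fintype.linearCombination R fun u : Fin g => X ^ (u : ℕ) * F

variable {F : R[X]} {P q g : ℕ}

theorem row_apply (s : ℕ) (k : R[X]) (l : Fin g) :
    row F P q g s k l = (k * F ^ (expo P q s - 1)).coeff (((l : ℕ) + 1) * P ^ s - 1) := rfl

theorem nrow_eq_vecMul (s : ℕ) (k : R[X]) :
    nrow F P q g s k = (row F P q g s k) ᵥ* (hwMatrix F P q g s)⁻¹ := rfl

theorem row_comb (s : ℕ) (c : Fin g → R) :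
    row F P q g s (comb F g c) = c ᵥ* hwMatrix F P q g s := by
  rw [comb, Fintype.linearCombination_apply, map_sum, Matrix.vecMul_eq_sum]
  simp only [map_smul]
  rfl

theorem natDegree_X_pow_mul_le (hF : F.natDegree ≤ q * g + 1) (u : Fin g) :
    (X ^ (u : ℕ) * F).natDegree ≤ q * g + g := by
  have hX := natDegree_X_pow_le (R := R) (u : ℕ)
  refine natDegree_mul_le.trans ?_
  omega

theorem natDegree_comb_le (hF : F.natDegree ≤ q * g + 1) (c : Fin g → R) :
    (comb F g c).natDegree ≤ q * g + g := by
  rw [comb, Fintype.linearCombination_apply]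
  exact natDegree_sum_le_of_forall_le _ _ fun u _ =>
    (natDegree_smul_le _ _).trans (natDegree_X_pow_mul_le hF u)

theorem nrow_vecMul_hwMatrix {s : ℕ} (hdet : IsUnit (hwMatrix F P q g s).det) (k : R[X]) :
    (nrow F P q g s k) ᵥ* hwMatrix F P q g s = row F P q g s k := by
  rw [nrow_eq_vecMul, Matrix.vecMul_vecMul, Matrix.nonsing_inv_mul _ hdet, Matrix.vecMul_one]

theorem nrow_comb {s : ℕ} (hdet : IsUnit (hwMatrix F P q g s).det) (c : Fin g → R) :
    nrow F P q g s (comb F g c) = c := by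
  rw [nrow_eq_vecMul, row_comb, Matrix.vecMul_vecMul, Matrix.mul_nonsing_inv _ hdet,
    Matrix.vecMul_one]

theorem row_sub_comb_nrow {s : ℕ} (hdet : IsUnit (hwMatrix F P q g s).det) (k : R[X]) :
    row F P q g s (k - comb F g (nrow F P q g s k)) = 0 := by
  rw [map_sub, row_comb, nrow_vecMul_hwMatrix hdet, sub_self]

theorem dvd_vecMul {ι κ : Type*} [Fintype ι] {x : R} {v : ι → R} (hv : ∀ u, x ∣ v u)
    (M : Matrix ι κ R) (l : κ) : x ∣ (v ᵥ* M) l :=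
  Finset.dvd_sum fun u _ => (hv u).mul_right _

end Rows

section DworkCongruences

open Polynomial

variable {R : Type*} [CommRing R] {F : R[X]} {p P q g : ℕ}

theorem coeff_mul_expand (Y H : R[X]) {N W : ℕ} (hN : 0 < N) (hW : 0 < W) :
    (Y * expand R N H).coeff (W * N - 1) =
      ∑ m ∈ Finset.range W, Y.coeff ((W - m) * N - 1) * H.coeff m := by
  induction H using Polynomial.induction_on' with
  | add a b ha hb => simp only [map_add, mul_add, coeff_add, ha, hb, Finset.sum_add_distrib]
  | monomial k c =>
    rw [expand_monomial, ← C_mul_X_pow_eq_monomial, ← mul_assoc, coeff_mul_X_pow', coeff_mul_C]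
    simp only [coeff_monomial]
    have hpos := Nat.mul_pos hW hN
    rcases lt_or_ge k W with hk | hk
    · have hkW : k * N + N ≤ W * N := by
        rw [← Nat.succ_mul]
        exact Nat.mul_le_mul_right _ hk
      rw [if_pos (by omega), Finset.sum_eq_single k
        (fun m _ hm => by rw [if_neg hm.symm, mul_zero])
        (fun h => absurd (Finset.mem_range.2 hk) h), if_pos rfl, Nat.sub_mul]
      congr 2
      omega
    · have hkW : W * N ≤ k * N := Nat.mul_le_mul_right _ hk
      rw [if_neg (by omega), Finset.sum_eq_zero]
      intro m hm
      rw [if_neg (by have := Finset.mem_range.1 hm; omega), mul_zero]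

theorem coeff_mul_pow_eq_zero {k : R[X]} {i w : ℕ} (hP : 1 < P) (hq : q ∣ P - 1)
    (hF : F.natDegree ≤ q * g + 1) (hk : k.natDegree ≤ q * g + g)
    (hi : 1 ≤ i) (hw : g < w) : (k * F ^ (expo P q i - 1)).coeff (w * P ^ i - 1) = 0 := by
  obtain ⟨N, hN⟩ : ∃ N, expo P q i = N + 1 :=
    ⟨_, (Nat.sub_add_cancel (expo_pos hP hq hi)).symm⟩
  obtain ⟨Q, hQ⟩ : ∃ Q, P ^ i = Q + 1 :=
    ⟨_, (Nat.sub_add_cancel (Nat.one_le_pow _ _ (by omega))).symm⟩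
  have hqN : q * (N + 1) = Q := by rw [← hN, mul_expo hq, hQ, Nat.add_sub_cancel]
  have hNQ : N + 1 ≤ Q := hqN ▸ Nat.le_mul_of_pos_left _ (pos_of_dvd_sub_one hP hq)
  rw [hN, hQ, Nat.add_sub_cancel]
  apply coeff_eq_zero_of_natDegree_lt
  calc (k * F ^ N).natDegree
      ≤ q * g + g + N * (q * g + 1) := natDegree_mul_le.trans <|
        add_le_add hk <| natDegree_pow_le.trans <| Nat.mul_le_mul_left _ hF
    _ = g * Q + g + N := by rw [← hqN]; ring
    _ < (g + 1) * (Q + 1) - 1 := by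
        rw [add_one_mul, mul_add_one]
        omega
    _ ≤ w * (Q + 1) - 1 := Nat.sub_le_sub_right (Nat.mul_le_mul_right _ hw) _

/-- `E ^ (P ^ r)` decomposes into pieces `p ^ j H_j (t ^ (P ^ (r - j)))`, for every `r`: a
polynomial form of the ghost components of Witt vectors. -/
def HasGhost (p P : ℕ) (E : R[X]) : Prop :=
  ∀ r, ∃ H : ℕ → R[X], E ^ P ^ r =
    ∑ j ∈ Finset.range (r + 1), C ((p : R) ^ j) * expand R (P ^ (r - j)) (H j)

theorem HasGhost.map {S : Type*} [CommRing S] (φ : R →+* S) {E : R[X]}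
    (h : HasGhost p P E) : HasGhost p P (E.map φ) := by
  intro r
  obtain ⟨H, hH⟩ := h r
  refine ⟨fun j => (H j).map φ, ?_⟩
  rw [← Polynomial.map_pow, hH, Polynomial.map_sum]
  simp only [Polynomial.map_mul, map_expand, C_pow, map_natCast, Polynomial.map_pow,
    Polynomial.map_natCast]

/-- Divisibility by `p ^ r` of the row of level `r` passes to all the coefficients of
`t ^ (w P ^ r - 1)` of every level `s ≥ r`. -/
def RowControls (F : R[X]) (p P q g r : ℕ) : Prop :=
  ∀ k : R[X], k.natDegree ≤ q * g + g → (∀ l, (p : R) ^ r ∣ row F P q g r k l) →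
    ∀ s w, r ≤ s → 1 ≤ w →
      (p : R) ^ r ∣ (k * F ^ (expo P q s - 1)).coeff (w * P ^ r - 1)

theorem RowControls.dvd_nrow_sub_nrow {r s : ℕ} (hctrl : RowControls F p P q g r) (hP : 1 < P)
    (hF : F.natDegree ≤ q * g + 1) (hdet_r : IsUnit (hwMatrix F P q g r).det)
    (hdet_s : IsUnit (hwMatrix F P q g s).det) (hrs : r ≤ s) {k : R[X]}
    (hk : k.natDegree ≤ q * g + g) (u : Fin g) :
    (p : R) ^ r ∣ nrow F P q g s k u - nrow F P q g r k u := by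
  set k' := k - comb F g (nrow F P q g r k) with hk'
  have hdeg : k'.natDegree ≤ q * g + g :=
    (natDegree_sub_le _ _).trans (max_le hk (natDegree_comb_le hF _))
  have hrow (l : Fin g) : (p : R) ^ r ∣ row F P q g s k' l := by
    have := hctrl k' hdeg (fun l => by rw [row_sub_comb_nrow hdet_r]; exact dvd_zero _) s
      ((l + 1) * P ^ (s - r)) hrs (Nat.mul_pos (Nat.succ_pos _) (pow_pos (by omega) _))
    rwa [mul_assoc, ← pow_add, Nat.sub_add_cancel hrs] at this
  have hnrow : nrow F P q g s k' = nrow F P q g s k - nrow F P q g r k := by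
    rw [hk', map_sub, nrow_comb hdet_s]
  rw [← Pi.sub_apply, ← hnrow]
  exact dvd_vecMul hrow _ u

theorem RowControls.dvd_row {r s : ℕ} (hctrl : RowControls F p P q g r) (hP : 1 < P)
    (hF : F.natDegree ≤ q * g + 1) (hdet_r : IsUnit (hwMatrix F P q g r).det)
    (hdet_s : IsUnit (hwMatrix F P q g s).det) (hrs : r ≤ s) {k : R[X]}
    (hk : k.natDegree ≤ q * g + g) (hrow : ∀ l, (p : R) ^ r ∣ row F P q g s k l) (l : Fin g) :
    (p : R) ^ r ∣ row F P q g r k l := by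
  rw [← nrow_vecMul_hwMatrix hdet_r]
  refine dvd_vecMul (fun u => ?_) _ l
  exact (dvd_sub_right (dvd_vecMul hrow _ u)).1
    (hctrl.dvd_nrow_sub_nrow hP hF hdet_r hdet_s hrs hk u)

theorem dvd_coeff_of_dvd_row {k : R[X]} {r w : ℕ} (hP : 1 < P) (hq : q ∣ P - 1)
    (hF : F.natDegree ≤ q * g + 1) (hk : k.natDegree ≤ q * g + g) (hr : 1 ≤ r) {x : R}
    (hrow : ∀ l, x ∣ row F P q g r k l) (hw : 1 ≤ w) :
    x ∣ (k * F ^ (expo P q r - 1)).coeff (w * P ^ r - 1) := by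
  rcases lt_or_ge g w with hgw | hwg
  · rw [coeff_mul_pow_eq_zero hP hq hF hk hr hgw]
    exact dvd_zero x
  · simpa only [row_apply, Nat.sub_add_cancel hw] using hrow ⟨w - 1, by omega⟩

theorem dvd_coeff_mul_ghost_piece {Y H : R[X]} {r j w : ℕ} (hP : 1 < P) (hj : j ≤ r)
    (hw : 1 ≤ w) (hY : ∀ w', 1 ≤ w' → (p : R) ^ (r - j) ∣ Y.coeff (w' * P ^ (r - j) - 1)) :
    (p : R) ^ r ∣
      (Y * (C ((p : R) ^ j) * expand R (P ^ (r - j)) H)).coeff (w * P ^ r - 1) := by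
  have hsplit : w * P ^ r = w * P ^ j * P ^ (r - j) := by
    rw [mul_assoc, ← pow_add, Nat.add_sub_cancel' hj]
  rw [mul_left_comm, coeff_C_mul, hsplit, coeff_mul_expand _ _ (pow_pos (by omega) _)
    (Nat.mul_pos hw (pow_pos (by omega) _)), ← Nat.add_sub_cancel' hj, pow_add,
    Nat.add_sub_cancel_left]
  refine mul_dvd_mul_left _ (Finset.dvd_sum fun m hm => (hY _ ?_).mul_right _)
  have := Finset.mem_range.1 hm
  omega

theorem rowControls (hP : 1 < P) (hq : q ∣ P - 1) (hF : F.natDegree ≤ q * g + 1)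
    (hgh : ∀ s, HasGhost p P (F ^ expo P q s))
    (hdet : ∀ s, 1 ≤ s → IsUnit (hwMatrix F P q g s).det) (r : ℕ) :
    RowControls F p P q g r := by
  induction r using Nat.strong_induction_on with
  | _ r ih =>
  intro k hk hrow s w hrs hw
  rcases Nat.eq_zero_or_pos r with rfl | hr
  · simp only [pow_zero, one_dvd]
  obtain ⟨d, rfl⟩ := Nat.exists_eq_add_of_le hrs
  obtain ⟨H, hH⟩ := hgh d r
  rw [expo_add_sub_one hP hq hr, pow_add, pow_mul, hH, ← mul_assoc, Finset.mul_sum,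
    finsetSum_coeff]
  refine Finset.dvd_sum fun j hj => ?_
  have hjr : j ≤ r := Nat.lt_succ_iff.1 (Finset.mem_range.1 hj)
  refine dvd_coeff_mul_ghost_piece hP hjr hw fun w' hw' => ?_
  rcases Nat.eq_zero_or_pos j with rfl | hj0
  · exact dvd_coeff_of_dvd_row hP hq hF hk hr hrow hw'
  rcases Nat.eq_zero_or_pos (r - j) with hrj | hrj
  · simp only [hrj, pow_zero, one_dvd]
  have hctrl := ih (r - j) (by omega)
  have hrow' : ∀ l, (p : R) ^ (r - j) ∣ row F P q g (r - j) k l :=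
    hctrl.dvd_row hP hF (hdet _ hrj) (hdet r hr) (Nat.sub_le r j) hk
      fun l => (pow_dvd_pow _ (Nat.sub_le r j)).trans (hrow l)
  exact hctrl k hk hrow' r w' (Nat.sub_le r j) hw'

theorem dvd_nrow_sub_nrow (hP : 1 < P) (hq : q ∣ P - 1) (hF : F.natDegree ≤ q * g + 1)
    (hgh : ∀ s, HasGhost p P (F ^ expo P q s))
    (hdet : ∀ s, 1 ≤ s → IsUnit (hwMatrix F P q g s).det) {r s : ℕ} (hr : 1 ≤ r) (hrs : r ≤ s)
    {k : R[X]} (hk : k.natDegree ≤ q * g + g) (u : Fin g) :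
    (p : R) ^ r ∣ nrow F P q g s k u - nrow F P q g r k u :=
  (rowControls hP hq hF hgh hdet r).dvd_nrow_sub_nrow hP hF (hdet r hr) (hdet s (hr.trans hrs))
    hrs hk u

end DworkCongruences

section FrobeniusLift

open Polynomial

variable {σ : Type*}

/-- The Frobenius lift on `ℤ[z][t]` which raises all the variables, `t` included, to the
power `P`. -/
def frobLift (σ : Type*) (P : ℕ) : (MvPolynomial σ ℤ)[X] →+* (MvPolynomial σ ℤ)[X] :=
  (expand (MvPolynomial σ ℤ) P).toRingHom.comp
    (mapRingHom (MvPolynomial.expand (R := ℤ) (σ := σ) P).toRingHom)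

theorem frobLift_apply (P : ℕ) (f : (MvPolynomial σ ℤ)[X]) :
    frobLift σ P f =
      expand (MvPolynomial σ ℤ) P (f.map (MvPolynomial.expand (R := ℤ) (σ := σ) P).toRingHom) :=
  rfl

theorem map_frobLift {Q : Type*} [CommRing Q] {p : ℕ} [Fact p.Prime] (hp : (p : Q) = 0)
    (π : (MvPolynomial σ ℤ)[X] →+* Q) (e : ℕ) (f : (MvPolynomial σ ℤ)[X]) :
    π (frobLift σ (p ^ e) f) = π f ^ p ^ e := by
  rcases subsingleton_or_nontrivial Q with hQ | hQ
  · exact Subsingleton.elim _ _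
  have : CharP Q p := (CharP.charP_iff_prime_eq_zero Fact.out).2 hp
  have hcomp : π.comp (frobLift σ (p ^ e)) = (iterateFrobenius Q p e).comp π := by
    apply Polynomial.ringHom_ext'
    · apply MvPolynomial.ringHom_ext
      · intro n
        simp
      · intro i
        simp [iterateFrobenius_def, frobLift_apply]
    · simp [iterateFrobenius_def, frobLift_apply]
  exact (RingHom.congr_fun hcomp f).trans (iterateFrobenius_def p e (π f))

theorem dvd_pow_sub_frobLift (p e : ℕ) [Fact p.Prime] (f : (MvPolynomial σ ℤ)[X]) :
    (p : (MvPolynomial σ ℤ)[X]) ∣ f ^ p ^ e - frobLift σ (p ^ e) f := by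
  set I : Ideal (MvPolynomial σ ℤ)[X] := Ideal.span {(p : (MvPolynomial σ ℤ)[X])} with hI
  have hp : (p : (MvPolynomial σ ℤ)[X] ⧸ I) = 0 := by
    rw [← map_natCast (Ideal.Quotient.mk I)]
    exact Ideal.Quotient.eq_zero_iff_mem.2 (Ideal.mem_span_singleton_self _)
  rw [← Ideal.mem_span_singleton, ← hI, ← Ideal.Quotient.eq_zero_iff_mem, map_sub, map_pow,
    sub_eq_zero]
  exact (map_frobLift (Q := (MvPolynomial σ ℤ)[X] ⧸ I) hp (Ideal.Quotient.mk I) e f).symm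

theorem dvd_pow_pow_sub_frobLift_pow {p e : ℕ} [Fact p.Prime] (he : 1 ≤ e) (r : ℕ)
    (f : (MvPolynomial σ ℤ)[X]) : (p : (MvPolynomial σ ℤ)[X]) ^ (r + 1) ∣
      f ^ (p ^ e) ^ (r + 1) - frobLift σ (p ^ e) (f ^ (p ^ e) ^ r) := by
  have h := dvd_sub_pow_of_dvd_sub (dvd_pow_sub_frobLift p e f) (e * r)
  rw [← pow_mul, pow_mul p e r, ← pow_succ', ← map_pow] at h
  exact (pow_dvd_pow _ (Nat.succ_le_succ (Nat.le_mul_of_pos_left r he))).trans h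

theorem frobLift_ghost_sum (p P r : ℕ) (H : ℕ → (MvPolynomial σ ℤ)[X]) :
    frobLift σ P (∑ j ∈ Finset.range (r + 1), C ((p : MvPolynomial σ ℤ) ^ j) *
        expand (MvPolynomial σ ℤ) (P ^ (r - j)) (H j)) =
      ∑ j ∈ Finset.range (r + 1), C ((p : MvPolynomial σ ℤ) ^ j) *
        expand (MvPolynomial σ ℤ) (P ^ (r + 1 - j))
          ((H j).map (MvPolynomial.expand (R := ℤ) (σ := σ) P).toRingHom) := by
  rw [map_sum]
  refine Finset.sum_congr rfl fun j hj => ?_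
  rw [map_mul, frobLift_apply, frobLift_apply, map_expand, expand_expand, ← pow_succ',
    Nat.sub_add_comm (Nat.lt_succ_iff.1 (Finset.mem_range.1 hj))]
  simp

theorem hasGhost_mvPolynomial {p e : ℕ} [Fact p.Prime] (he : 1 ≤ e)
    (f : (MvPolynomial σ ℤ)[X]) : HasGhost p (p ^ e) f := by
  intro r
  induction r with
  | zero => exact ⟨fun _ => f, by simp⟩
  | succ r ih =>
    obtain ⟨H, hH⟩ := ih
    obtain ⟨G, hG⟩ := dvd_pow_pow_sub_frobLift_pow (p := p) he r f
    rw [sub_eq_iff_eq_add, hH, frobLift_ghost_sum] at hG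
    refine ⟨fun j => if j ≤ r then
      (H j).map (MvPolynomial.expand (R := ℤ) (σ := σ) (p ^ e)).toRingHom else G, ?_⟩
    rw [hG, Finset.sum_range_succ _ (r + 1), add_comm (_ * G)]
    refine congrArg₂ (· + ·) (Finset.sum_congr rfl fun j hj => ?_) ?_
    · simp only [if_pos (Nat.lt_succ_iff.1 (Finset.mem_range.1 hj))]
    · simp only [Nat.not_succ_le_self r, if_false, Nat.sub_self, pow_zero, expand_one, C_pow,
        map_natCast]

end FrobeniusLift

section BaseChange

open Polynomial
open scoped Matrix

variable {R S : Type*} [CommRing R] [CommRing S] {F : R[X]} {P q g s : ℕ}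

theorem row_map (φ : R →+* S) (k : R[X]) :
    row (F.map φ) P q g s (k.map φ) = φ ∘ row F P q g s k := by
  ext l
  rw [Function.comp_apply, row_apply, row_apply, ← Polynomial.map_pow, ← Polynomial.map_mul,
    coeff_map]

theorem hwMatrix_map (φ : R →+* S) :
    hwMatrix (F.map φ) P q g s = (hwMatrix F P q g s).map φ := by
  ext u l
  have h := congrFun (row_map (F := F) (P := P) (q := q) (g := g) (s := s) φ (X ^ (u : ℕ) * F)) l
  rwa [Polynomial.map_mul, Polynomial.map_pow, map_X] at h

theorem det_hwMatrix_map (φ : R →+* S) :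
    (hwMatrix (F.map φ) P q g s).det = φ (hwMatrix F P q g s).det := by
  rw [hwMatrix_map, ← RingHom.mapMatrix_apply, ← RingHom.map_det]

theorem nrow_map (φ : R →+* S) (hdet : IsUnit (hwMatrix F P q g s).det) (k : R[X]) :
    nrow (F.map φ) P q g s (k.map φ) = φ ∘ nrow F P q g s k := by
  have hdet' : IsUnit (hwMatrix (F.map φ) P q g s).det := by
    rw [det_hwMatrix_map]
    exact hdet.map φ
  have hrow : (φ ∘ nrow F P q g s k) ᵥ* hwMatrix (F.map φ) P q g s =
      row (F.map φ) P q g s (k.map φ) := by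
    ext l
    rw [hwMatrix_map, row_map, ← nrow_vecMul_hwMatrix hdet, Function.comp_apply,
      RingHom.map_vecMul]
  rw [nrow_eq_vecMul, ← hrow, Matrix.vecMul_vecMul, Matrix.mul_nonsing_inv _ hdet',
    Matrix.vecMul_one]

end BaseChange

section HasseWittDeterminant

open Polynomial
open scoped Matrix

variable {R : Type*} [CommRing R] {F : R[X]}

/-- The numerical conditions on `p`, `e`, `q`, `g` under which the theory works: `p ^ e ≡ 1`
modulo `q` and `p ^ e` exceeds the number `g` of solutions. -/
structure Admissible (p e q g : ℕ) : Prop where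
  e_pos : 1 ≤ e
  dvd : q ∣ p ^ e - 1
  lt : g < p ^ e

theorem Admissible.one_lt {p e q g : ℕ} [Fact p.Prime] (h : Admissible p e q g) : 1 < p ^ e :=
  Nat.one_lt_pow (Nat.ne_of_gt h.e_pos) (Fact.out : p.Prime).one_lt

theorem row_succ {p e q g : ℕ} [Fact p.Prime] [CharP R p] (ha : Admissible p e q g)
    (hF : F.natDegree ≤ q * g + 1) {s : ℕ} (hs : 1 ≤ s) {k : R[X]}
    (hk : k.natDegree ≤ q * g + g) :
    row F (p ^ e) q g (s + 1) k = row F (p ^ e) q g s k ᵥ*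
      (hwMatrix F (p ^ e) q g 1).map (iterateFrobenius R p (e * s)) := by
  obtain ⟨hP, hq⟩ := And.intro ha.one_lt ha.dvd
  have hfrob : (F ^ expo (p ^ e) q 1) ^ (p ^ e) ^ s =
      expand R ((p ^ e) ^ s) ((F ^ expo (p ^ e) q 1).map (iterateFrobenius R p (e * s))) := by
    rw [← map_expand, ← pow_mul p, map_iterateFrobenius_expand]
  ext l
  have hl : ((l : ℕ) + 1) * (p ^ e) ^ (s + 1) = (((l : ℕ) + 1) * p ^ e) * (p ^ e) ^ s := by
    ring
  have hgW : g ≤ ((l : ℕ) + 1) * p ^ e :=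
    ha.lt.le.trans (Nat.le_mul_of_pos_left _ (Nat.succ_pos _))
  rw [row_apply, expo_add_sub_one hP hq hs, pow_add, pow_mul, hfrob, ← mul_assoc, hl,
    coeff_mul_expand _ _ (pow_pos (by omega) _) (Nat.mul_pos l.1.succ_pos (by omega)),
    ← Nat.add_one, ← Finset.sum_range_reflect, ← Finset.sum_range_add_sum_Ico _ hgW,
    Finset.sum_range, Finset.sum_eq_zero (s := Finset.Ico _ _), add_zero]
  · refine Finset.sum_congr rfl fun u _ => ?_
    have hu := u.2
    change _ = row F (p ^ e) q g s k u *
      iterateFrobenius R p (e * s) (row F (p ^ e) q g 1 (X ^ (u : ℕ) * F) l)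
    rw [row_apply, row_apply, coeff_map, mul_assoc,
      ← pow_succ', Nat.sub_add_cancel (expo_pos hP hq le_rfl), coeff_X_pow_mul',
      if_pos (by rw [pow_one]; omega), pow_one]
    congr 4
    omega
  · intro m hm
    obtain ⟨hgm, hmW⟩ := Finset.mem_Ico.1 hm
    rw [coeff_mul_pow_eq_zero hP hq hF hk hs (by omega), zero_mul]

theorem hwMatrix_succ {p e q g : ℕ} [Fact p.Prime] [CharP R p] (ha : Admissible p e q g)
    (hF : F.natDegree ≤ q * g + 1) {s : ℕ} (hs : 1 ≤ s) :
    hwMatrix F (p ^ e) q g (s + 1) = hwMatrix F (p ^ e) q g s *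
      (hwMatrix F (p ^ e) q g 1).map (iterateFrobenius R p (e * s)) := by
  ext u l
  exact congrFun (row_succ ha hF hs (natDegree_X_pow_mul_le hF u)) l

theorem det_hwMatrix_succ {p e q g : ℕ} [Fact p.Prime] [CharP R p] (ha : Admissible p e q g)
    (hF : F.natDegree ≤ q * g + 1) {s : ℕ} (hs : 1 ≤ s) :
    (hwMatrix F (p ^ e) q g (s + 1)).det =
      (hwMatrix F (p ^ e) q g s).det * (hwMatrix F (p ^ e) q g 1).det ^ p ^ (e * s) := by
  rw [hwMatrix_succ ha hF hs, Matrix.det_mul, ← RingHom.mapMatrix_apply, ← RingHom.map_det,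
    iterateFrobenius_def]

theorem isUnit_det_hwMatrix [IsLocalRing R] {p e q g : ℕ} [Fact p.Prime]
    (ha : Admissible p e q g) (hp : ¬ IsUnit (p : R)) (hF : F.natDegree ≤ q * g + 1)
    (hdet : IsUnit (hwMatrix F (p ^ e) q g 1).det) {s : ℕ} (hs : 1 ≤ s) :
    IsUnit (hwMatrix F (p ^ e) q g s).det := by
  have : CharP (IsLocalRing.ResidueField R) p := by
    refine (CharP.charP_iff_prime_eq_zero Fact.out).2 ?_
    rwa [← map_natCast (IsLocalRing.residue R), IsLocalRing.residue_eq_zero_iff]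
  rw [← IsLocalRing.residue_ne_zero_iff_isUnit, ← det_hwMatrix_map] at hdet ⊢
  induction s, hs using Nat.le_induction with
  | base => exact hdet
  | succ s hs ih =>
    rw [det_hwMatrix_succ ha (natDegree_map_le.trans hF) hs]
    exact mul_ne_zero ih (pow_ne_zero _ hdet)

end HasseWittDeterminant

section Specialization

open Polynomial

variable {R S : Type*} [CommRing R] [CommRing S] {n : ℕ}

/-- The polynomial `(t - z_1) ⋯ (t - z_n)`. -/
def rootPoly (z : Fin n → R) : R[X] := ∏ j, (X - C (z j))

/-- The polynomial `(t - z_1) ⋯ (t - z_n) / (t - z_i)`. -/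
def cofactorPoly (z : Fin n → R) (i : Fin n) : R[X] := ∏ j ∈ Finset.univ.erase i, (X - C (z j))

theorem mul_cofactorPoly (z : Fin n → R) (i : Fin n) :
    (X - C (z i)) * cofactorPoly z i = rootPoly z :=
  Finset.mul_prod_erase Finset.univ (fun j => X - C (z j)) (Finset.mem_univ i)

theorem map_rootPoly (φ : R →+* S) (z : Fin n → R) :
    (rootPoly z).map φ = rootPoly (φ ∘ z) := by
  simp [rootPoly, Polynomial.map_prod]

theorem map_cofactorPoly (φ : R →+* S) (z : Fin n → R) (i : Fin n) :
    (cofactorPoly z i).map φ = cofactorPoly (φ ∘ z) i := by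
  simp [cofactorPoly, Polynomial.map_prod]

theorem natDegree_rootPoly_le (z : Fin n → R) : (rootPoly z).natDegree ≤ n :=
  (natDegree_prod_le _ _).trans <|
    (Finset.sum_le_sum fun j _ => natDegree_X_sub_C_le (z j)).trans (by simp)

theorem natDegree_cofactorPoly_le (z : Fin n → R) (i : Fin n) :
    (cofactorPoly z i).natDegree ≤ n - 1 :=
  (natDegree_prod_le _ _).trans <| (Finset.sum_le_sum fun j _ =>
    natDegree_X_sub_C_le (z j)).trans (by simp [Finset.card_erase_of_mem])

/-- The specialization of integral polynomials in `z_1, …, z_n` at a point. -/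
def spec (z : Fin n → R) : MvPolynomial (Fin n) ℤ →+* R := (MvPolynomial.aeval z).toRingHom

theorem spec_X (z : Fin n → R) (i : Fin n) : spec z (MvPolynomial.X i) = z i :=
  MvPolynomial.aeval_X z i

theorem spec_comp_X (z : Fin n → R) : spec z ∘ MvPolynomial.X = z :=
  funext (spec_X z)

theorem comp_spec (φ : R →+* S) (z : Fin n → R) : φ.comp (spec z) = spec (φ ∘ z) := by
  apply MvPolynomial.ringHom_ext
  · intro m
    simp
  · intro i
    simp [spec_X]

theorem map_spec_rootPoly (z : Fin n → R) :
    (rootPoly MvPolynomial.X).map (spec z) = rootPoly z := by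
  rw [map_rootPoly, spec_comp_X]

theorem map_spec_cofactorPoly (z : Fin n → R) (i : Fin n) :
    (cofactorPoly MvPolynomial.X i).map (spec z) = cofactorPoly z i := by
  rw [map_cofactorPoly, spec_comp_X]

theorem map_map_spec (φ : R →+* S) (z : Fin n → R) (k : (MvPolynomial (Fin n) ℤ)[X]) :
    (k.map (spec z)).map φ = k.map (spec (φ ∘ z)) := by
  rw [Polynomial.map_map, comp_spec]

theorem hasGhost_rootPoly_pow {p e : ℕ} [Fact p.Prime] (he : 1 ≤ e) (z : Fin n → R) (N : ℕ) :
    HasGhost p (p ^ e) (rootPoly z ^ N) := by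
  have h := (hasGhost_mvPolynomial (p := p) he (rootPoly MvPolynomial.X ^ N)).map (spec z)
  rwa [Polynomial.map_pow, map_spec_rootPoly] at h

/-- The value at `z` of the normalized row attached to a polynomial `k` over `ℤ[z]`. -/
def nrowAt (P q g s : ℕ) (k : (MvPolynomial (Fin n) ℤ)[X]) (z : Fin n → R) : Fin g → R :=
  nrow (rootPoly z) P q g s (k.map (spec z))

theorem nrowAt_map (φ : R →+* S) {P q g s : ℕ} {z : Fin n → R}
    (hdet : IsUnit (hwMatrix (rootPoly z) P q g s).det) (k : (MvPolynomial (Fin n) ℤ)[X]) :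
    nrowAt P q g s k (φ ∘ z) = φ ∘ nrowAt P q g s k z := by
  rw [nrowAt, nrowAt, ← nrow_map φ hdet, map_rootPoly, map_map_spec]

theorem dvd_nrowAt_sub_nrowAt [IsLocalRing R] {p e q g : ℕ} [Fact p.Prime]
    (ha : Admissible p e q g) (hp : ¬ IsUnit (p : R)) {z : Fin (q * g + 1) → R}
    (hdet : IsUnit (hwMatrix (rootPoly z) (p ^ e) q g 1).det) {r s : ℕ} (hr : 1 ≤ r) (hrs : r ≤ s)
    {k : (MvPolynomial (Fin (q * g + 1)) ℤ)[X]} (hk : k.natDegree ≤ q * g + g) (u : Fin g) :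
    (p : R) ^ r ∣ nrowAt (p ^ e) q g s k z u - nrowAt (p ^ e) q g r k z u :=
  dvd_nrow_sub_nrow ha.one_lt ha.dvd (natDegree_rootPoly_le z)
    (fun _ => hasGhost_rootPoly_pow ha.e_pos z _)
    (fun _ hs => isUnit_det_hwMatrix ha hp (natDegree_rootPoly_le z) hdet hs) hr hrs
    (natDegree_map_le.trans hk) u

end Specialization

section HypergeometricSolutions

open Polynomial

theorem masterPoly_eq {p q g s : ℕ} :
    masterPoly p q g s = rootPoly MvPolynomial.X ^ expo (p ^ ord p q) q s := by
  rw [masterPoly, rootPoly, expo, pow_mul]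

theorem hypSol_apply {p q g s : ℕ} (hs : 0 < expo (p ^ ord p q) q s) (i : Fin (q * g + 1))
    (l : Fin g) : hypSol p q g s i l =
      row (rootPoly MvPolynomial.X) (p ^ ord p q) q g s (cofactorPoly MvPolynomial.X i) l := by
  obtain ⟨N, hN⟩ : ∃ N, expo (p ^ ord p q) q s = N + 1 := ⟨_, (Nat.sub_add_cancel hs).symm⟩
  rw [hypSol, Matrix.of_apply, masterPoly_eq, row_apply, hN, Nat.add_sub_cancel, pow_mul,
    pow_succ', ← mul_cofactorPoly MvPolynomial.X i, mul_assoc,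
    mul_divByMonic_cancel_left _ (monic_X_sub_C _)]

theorem hasseWitt_eq {p q g s : ℕ} (hs : 0 < expo (p ^ ord p q) q s)
    (hg : g < (p ^ ord p q) ^ s) : hasseWitt p q g s =
      hwMatrix (rootPoly MvPolynomial.X) (p ^ ord p q) q g s := by
  ext1 u v
  have hu := u.2
  have hv : (p ^ ord p q) ^ s * 1 ≤ (p ^ ord p q) ^ s * ((v : ℕ) + 1) :=
    Nat.mul_le_mul_left _ (by omega)
  rw [hasseWitt, Matrix.of_apply, masterPoly_eq, hwMatrix, Matrix.of_apply, row_apply, mul_assoc,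
    mul_pow_sub_one hs.ne', pow_mul, coeff_X_pow_mul', mul_comm ((v : ℕ) + 1), if_pos (by omega)]
  congr 1
  omega

end HypergeometricSolutions

section Integers

variable (K : Type*) [NontriviallyNormedField K] [IsUltrametricDist K]

/-- The ring of integers `{x : ‖x‖ ≤ 1}`. -/
abbrev integers : ValuationSubring K := (NormedField.valuation (K := K)).valuationSubring

variable {K}

theorem norm_integers_le (x : integers K) : ‖(x : K)‖ ≤ 1 := x.2

theorem isUnit_integers_iff {x : integers K} : IsUnit x ↔ ‖(x : K)‖ = 1 := by
  rw [Valuation.Integers.isUnit_iff_valuation_eq_one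
    (Valuation.valuationSubring.integers (NormedField.valuation (K := K)))]
  exact NNReal.coe_eq_one.symm

instance : IsLinearTopology (integers K) (integers K) :=
  let ballIdeal (r : {r : ℝ // 0 < r}) : Ideal (integers K) :=
    { IsUltrametricDist.ball_openAddSubgroup (integers K) r.2 with
      smul_mem' := fun c x hx => mem_ball_zero_iff.2 <| (norm_mul_le c x).trans_lt <|
        (mul_le_of_le_one_left (norm_nonneg x) (norm_integers_le c)).trans_lt
          (mem_ball_zero_iff.1 hx) }
  IsLinearTopology.mk_of_hasBasis (integers K) (p := fun _ => True) (s := ballIdeal) <|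
    Metric.nhds_basis_ball.to_hasBasis (fun r hr => ⟨⟨r, hr⟩, trivial, subset_rfl⟩)
      fun r _ => ⟨r, r.2, subset_rfl⟩

instance [CompleteSpace K] : CompleteSpace (integers K) :=
  completeSpace_coe_iff_isComplete.2 <| by
    convert! (Metric.isClosed_closedBall (x := (0 : K)) (ε := 1)).isComplete
    ext
    exact mem_closedBall_zero_iff.symm

end Integers

section PowerSeries

open MvPowerSeries
open scoped MvPowerSeries.WithPiTopology

variable {K : Type*} [NontriviallyNormedField K] {σ : Type*} {m : ℕ}

/-- The monomial `y ↦ ∏ i ∈ s, y i` attached to a multiset `s` with `m` elements, as the diagonal of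
a multilinear map; the factors are distributed over the `m` arguments in an arbitrary order. -/
def monomialMap (K : Type*) [NontriviallyNormedField K] (s : Sym σ m) :
    ContinuousMultilinearMap K (fun _ : Fin m => σ → K) K :=
  (ContinuousMultilinearMap.mkPiAlgebra K (Fin m) K).compContinuousLinearMap fun j =>
    ContinuousLinearMap.proj (s.1.toList.get (j.cast (by simp)))

theorem monomialMap_diag (s : Sym σ m) (y : σ → K) :
    monomialMap K s (fun _ => y) = (s.1.map y).prod := by
  have hlist : (s.1.map y).prod = (s.1.toList.map y).prod := by
    rw [← Multiset.prod_coe, ← Multiset.map_coe, Multiset.coe_toList]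
  rw [hlist, ← List.ofFn_get s.1.toList, List.map_ofFn, List.prod_ofFn]
  exact Fintype.prod_equiv (finCongr (by simp)) _ _ fun _ => rfl

theorem norm_monomialMap_le [Fintype σ] (s : Sym σ m) (v : Fin m → σ → K) :
    ‖monomialMap K s v‖ ≤ ∏ j, ‖v j‖ := by
  rw [monomialMap, ContinuousMultilinearMap.compContinuousLinearMap_apply,
    ContinuousMultilinearMap.mkPiAlgebra_apply, norm_prod]
  exact Finset.prod_le_prod (fun _ _ => norm_nonneg _) fun j _ => norm_le_pi_norm (v j) _

variable [IsUltrametricDist K]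

theorem hasEval_integers [Finite σ] {y : σ → integers K} (hy : ∀ i, ‖y i‖ < 1) : HasEval y where
  hpow i := tendsto_pow_atTop_nhds_zero_of_norm_lt_one (hy i)
  tendsto_zero := by simp [Filter.cofinite_eq_bot]

variable [Fintype σ] [DecidableEq σ]

/-- A power series with integral coefficients, as a formal multilinear series. -/
def formalSeries (f : MvPowerSeries σ (integers K)) : FormalMultilinearSeries K (σ → K) K :=
  fun m => ∑ s : Sym σ m, ((coeff (Multiset.toFinsupp s.1) f : integers K) : K) • monomialMap K s

theorem formalSeries_apply (f : MvPowerSeries σ (integers K)) (v : Fin m → σ → K) :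
    formalSeries f m v =
      ∑ s : Sym σ m, (coeff (Multiset.toFinsupp s.1) f : integers K) * monomialMap K s v := by
  simp [formalSeries]

theorem one_le_radius_formalSeries (f : MvPowerSeries σ (integers K)) :
    1 ≤ (formalSeries f).radius := by
  refine FormalMultilinearSeries.le_radius_of_bound _ 1 fun m => ?_
  rw [NNReal.coe_one, one_pow, mul_one]
  refine ContinuousMultilinearMap.opNorm_le_bound zero_le_one fun v => ?_
  rw [one_mul, formalSeries_apply]
  refine IsUltrametricDist.norm_sum_le_of_forall_le_of_nonneg
    (Finset.prod_nonneg fun _ _ => norm_nonneg _) fun s _ => ?_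
  rw [norm_mul]
  exact (mul_le_of_le_one_left (norm_nonneg _) (norm_integers_le _)).trans
    (norm_monomialMap_le s v)

theorem formalSeries_one_single (f : MvPowerSeries σ (integers K)) (i : σ) :
    formalSeries f 1 (fun _ => Pi.single i 1) = coeff (Finsupp.single i 1) f := by
  have hval (j : σ) : (Sym.oneEquiv j).1 = {j} := rfl
  rw [formalSeries_apply, ← Sym.oneEquiv.sum_comp, Finset.sum_eq_single i]
  · rw [monomialMap_diag, hval]
    simp
  · intro j _ hj
    rw [monomialMap_diag, hval]
    simp [hj]
  · simp

theorem fderiv_single_of_hasFPowerSeriesOnBall {F : (σ → K) → K} {a : σ → K}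
    {f : MvPowerSeries σ (integers K)} (h : HasFPowerSeriesOnBall F (formalSeries f) a 1) (i : σ) :
    fderiv K F a (Pi.single i 1) = (coeff (Finsupp.single i 1) f : integers K) := by
  rw [← formalSeries_one_single, h.hasFPowerSeriesAt.fderiv_eq,
    continuousMultilinearCurryFin1_apply]
  congr 1

variable [CompleteSpace K]

theorem hasSum_formalSeries (f : MvPowerSeries σ (integers K)) {y : σ → integers K}
    (hy : ∀ i, ‖y i‖ < 1) :
    HasSum (fun m => formalSeries f m fun _ i => (y i : K))
      (aeval (hasEval_integers hy) f : integers K) := by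
  let byDegree : (Σ m, Sym σ m) ≃ (σ →₀ ℕ) :=
    (Equiv.sigmaFiberEquiv Multiset.card).trans Multiset.toFinsupp.toEquiv
  have hterm (s : Σ m, Sym σ m) :
      ((coeff (byDegree s) f • (byDegree s).prod fun i k => y i ^ k : integers K) : K) =
        (coeff (Multiset.toFinsupp s.2.1) f : integers K) * monomialMap K s.2 fun _ i => y i := by
    rw [monomialMap_diag, Finset.prod_multiset_map_count, smul_eq_mul, Finsupp.prod]
    push_cast
    rfl
  have hsum := byDegree.hasSum_iff.2 ((hasSum_aeval (hasEval_integers hy) f).map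
    (integers K).subtype continuous_subtype_val)
  refine HasSum.sigma (hsum.congr_fun fun s => (hterm s).symm) fun m => ?_
  rw [formalSeries_apply]
  exact hasSum_fintype _

theorem hasFPowerSeriesOnBall_of_eq_aeval (f : MvPowerSeries σ (integers K)) {F : (σ → K) → K}
    {a : σ → K} (hF : ∀ (y : σ → integers K) (hy : ∀ i, ‖y i‖ < 1),
      F (a + fun i => (y i : K)) = (aeval (hasEval_integers hy) f : integers K)) :
    HasFPowerSeriesOnBall F (formalSeries f) a 1 := by
  refine ⟨one_le_radius_formalSeries f, one_pos, fun {x} hx => ?_⟩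
  rw [Metric.mem_eball, edist_zero_right, ← ofReal_norm, ENNReal.ofReal_lt_one] at hx
  have hx1 : ∀ i, ‖x i‖ < 1 := fun i => (norm_le_pi_norm x i).trans_lt hx
  obtain ⟨y, rfl⟩ : ∃ y : σ → integers K, (fun i => (y i : K)) = x :=
    ⟨fun i => ⟨x i, (hx1 i).le⟩, rfl⟩
  rw [hF y hx1]
  exact hasSum_formalSeries f hx1

end PowerSeries

section TaylorPoint

open MvPowerSeries

variable {R : Type*} [CommRing R] {n : ℕ}

/-- The point `z + X` with power series coordinates; evaluating `X` at a small `y` turns functions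
of `z + X` into their Taylor expansions at `z`. -/
def taylorPoint (z : Fin n → R) : Fin n → MvPowerSeries (Fin n) R := fun i => C (z i) + X i

theorem constantCoeff_comp_taylorPoint (z : Fin n → R) :
    constantCoeff ∘ taylorPoint z = z := by
  ext i
  simp [taylorPoint]

theorem isUnit_det_taylorPoint {P q g s : ℕ} {z : Fin n → R}
    (hdet : IsUnit (hwMatrix (rootPoly z) P q g s).det) :
    IsUnit (hwMatrix (rootPoly (taylorPoint z)) P q g s).det := by
  rwa [isUnit_iff_constantCoeff, ← det_hwMatrix_map, map_rootPoly, constantCoeff_comp_taylorPoint]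

variable {K : Type*} [NontriviallyNormedField K] [IsUltrametricDist K] [CompleteSpace K]

theorem aeval_comp_taylorPoint (z : Fin n → integers K) {y : Fin n → integers K}
    (hy : ∀ i, ‖y i‖ < 1) : aeval (hasEval_integers hy) ∘ taylorPoint z = z + y := by
  ext1 i
  rw [Function.comp_apply, taylorPoint, map_add, c_eq_algebraMap, AlgHom.commutes,
    ← MvPolynomial.coe_X, aeval_coe, MvPolynomial.aeval_X]
  rfl

end TaylorPoint

section UnitDomain

variable {K : Type*} [NontriviallyNormedField K] [IsUltrametricDist K]

instance : IsLocalRing (integers K) := by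
  refine IsLocalRing.of_nonunits_add fun a b ha hb => ?_
  rw [mem_nonunits_iff, isUnit_integers_iff] at *
  have ha' := lt_of_le_of_ne (norm_integers_le a) ha
  have hb' := lt_of_le_of_ne (norm_integers_le b) hb
  exact ((IsUltrametricDist.norm_add_le_max (a : K) b).trans_lt (max_lt ha' hb')).ne

theorem not_isUnit_natCast_integers {p : ℕ} (hp : ‖(p : K)‖ < 1) : ¬ IsUnit (p : integers K) := by
  rw [isUnit_integers_iff]
  simpa using hp.ne

theorem norm_le_pow_of_natCast_pow_dvd {p r : ℕ} {x : integers K}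
    (h : (p : integers K) ^ r ∣ x) : ‖x‖ ≤ ‖(p : K)‖ ^ r := by
  obtain ⟨y, rfl⟩ := h
  rw [norm_mul, norm_pow]
  exact mul_le_of_le_one_right (by positivity) (norm_integers_le y)

/-- The points with integral coordinates at which the first Hasse-Witt determinant is a unit. -/
def unitDomain (K : Type*) [NontriviallyNormedField K] (P q g : ℕ) :
    Set (Fin (q * g + 1) → K) :=
  {a | (∀ i, ‖a i‖ ≤ 1) ∧ ‖(hwMatrix (rootPoly a) P q g 1).det‖ = 1}

theorem isUnit_det_hwMatrix_integers_iff {n P q g s : ℕ} {z : Fin n → integers K} :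
    IsUnit (hwMatrix (rootPoly z) P q g s).det ↔
      ‖(hwMatrix (rootPoly ((integers K).subtype ∘ z)) P q g s).det‖ = 1 := by
  rw [isUnit_integers_iff, ← map_rootPoly, det_hwMatrix_map]
  rfl

theorem exists_integers_of_mem_unitDomain {P q g : ℕ} {a : Fin (q * g + 1) → K}
    (h : a ∈ unitDomain K P q g) : ∃ z : Fin (q * g + 1) → integers K,
      IsUnit (hwMatrix (rootPoly z) P q g 1).det ∧ (integers K).subtype ∘ z = a :=
  ⟨fun i => ⟨a i, h.1 i⟩, isUnit_det_hwMatrix_integers_iff.2 h.2, rfl⟩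

theorem norm_det_hwMatrix_eq_one {p e q g : ℕ} [Fact p.Prime] (ha : Admissible p e q g)
    (hp : ‖(p : K)‖ < 1) {a : Fin (q * g + 1) → K} (h : a ∈ unitDomain K (p ^ e) q g) {s : ℕ}
    (hs : 1 ≤ s) : ‖(hwMatrix (rootPoly a) (p ^ e) q g s).det‖ = 1 := by
  obtain ⟨z, hz, rfl⟩ := exists_integers_of_mem_unitDomain h
  exact isUnit_det_hwMatrix_integers_iff.1 <|
    isUnit_det_hwMatrix ha (not_isUnit_natCast_integers hp) (natDegree_rootPoly_le z) hz hs

theorem isUnit_det_hwMatrix_of_mem {p e q g : ℕ} [Fact p.Prime] (ha : Admissible p e q g)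
    (hp : ‖(p : K)‖ < 1) {a : Fin (q * g + 1) → K} (h : a ∈ unitDomain K (p ^ e) q g) {s : ℕ}
    (hs : 1 ≤ s) : IsUnit (hwMatrix (rootPoly a) (p ^ e) q g s).det :=
  isUnit_iff_ne_zero.2 <| norm_ne_zero_iff.1 <|
    (norm_det_hwMatrix_eq_one ha hp h hs).symm ▸ one_ne_zero

end UnitDomain

section TaylorExpansion

open MvPowerSeries

variable {K : Type*} [NontriviallyNormedField K] [IsUltrametricDist K] [CompleteSpace K]

theorem add_mem_unitDomain {P q g : ℕ} {a y : Fin (q * g + 1) → K} (h : a ∈ unitDomain K P q g)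
    (hy : ∀ i, ‖y i‖ < 1) : a + y ∈ unitDomain K P q g := by
  obtain ⟨z, hz, rfl⟩ := exists_integers_of_mem_unitDomain h
  obtain ⟨y, rfl⟩ : ∃ y' : Fin (q * g + 1) → integers K, (integers K).subtype ∘ y' = y :=
    ⟨fun i => ⟨y i, (hy i).le⟩, rfl⟩
  have hunit : IsUnit (hwMatrix (rootPoly (z + y)) P q g 1).det := by
    rw [← aeval_comp_taylorPoint z hy, ← AlgHom.coe_toRingHom, ← map_rootPoly, det_hwMatrix_map]
    exact (isUnit_det_taylorPoint hz).map _
  have hadd : (integers K).subtype ∘ (z + y) =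
      (integers K).subtype ∘ z + (integers K).subtype ∘ y := rfl
  rw [← hadd]
  exact ⟨fun i => norm_integers_le ((z + y) i), isUnit_det_hwMatrix_integers_iff.1 hunit⟩

theorem eventually_mem_unitDomain {P q g : ℕ} {a : Fin (q * g + 1) → K}
    (h : a ∈ unitDomain K P q g) : ∀ᶠ x in 𝓝 a, x ∈ unitDomain K P q g := by
  filter_upwards [Metric.ball_mem_nhds a one_pos] with x hx
  rw [← add_sub_cancel a x]
  exact add_mem_unitDomain h fun i =>
    (norm_le_pi_norm (x - a) i).trans_lt (mem_ball_iff_norm.1 hx)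

theorem nrowAt_add_eq_aeval {n P q g s : ℕ} {z : Fin n → integers K}
    (hdet : IsUnit (hwMatrix (rootPoly z) P q g s).det)
    (k : Polynomial (MvPolynomial (Fin n) ℤ)) {y : Fin n → integers K} (hy : ∀ i, ‖y i‖ < 1)
    (u : Fin g) : nrowAt P q g s k ((integers K).subtype ∘ z + fun i => (y i : K)) u =
      (aeval (hasEval_integers hy) (nrowAt P q g s k (taylorPoint z) u) : integers K) := by
  have h := nrowAt_map ((integers K).subtype.comp (aeval (hasEval_integers hy)).toRingHom)
    (isUnit_det_taylorPoint hdet) k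
  rw [RingHom.coe_comp, AlgHom.toRingHom_eq_coe, AlgHom.coe_toRingHom, Function.comp_assoc,
    aeval_comp_taylorPoint z hy] at h
  exact congrFun h u

theorem hasFPowerSeriesOnBall_nrowAt {n P q g s : ℕ} {z : Fin n → integers K}
    (hdet : IsUnit (hwMatrix (rootPoly z) P q g s).det)
    (k : Polynomial (MvPolynomial (Fin n) ℤ)) (u : Fin g) :
    HasFPowerSeriesOnBall (fun x => nrowAt P q g s k x u)
      (formalSeries (nrowAt P q g s k (taylorPoint z) u)) ((integers K).subtype ∘ z) 1 :=
  hasFPowerSeriesOnBall_of_eq_aeval _ fun _ hy => nrowAt_add_eq_aeval hdet k hy u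

end TaylorExpansion

section Limits

open MvPowerSeries
open scoped MvPowerSeries.WithPiTopology

variable {K : Type*} [NontriviallyNormedField K] [IsUltrametricDist K]

theorem norm_nrowAt_sub_le {p e q g : ℕ} [Fact p.Prime] (ha : Admissible p e q g)
    (hp : ‖(p : K)‖ < 1) {a : Fin (q * g + 1) → K} (h : a ∈ unitDomain K (p ^ e) q g) {r s : ℕ}
    (hr : 1 ≤ r) (hrs : r ≤ s) {k : Polynomial (MvPolynomial (Fin (q * g + 1)) ℤ)}
    (hk : k.natDegree ≤ q * g + g) :
    ‖nrowAt (p ^ e) q g s k a - nrowAt (p ^ e) q g r k a‖ ≤ ‖(p : K)‖ ^ r := by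
  obtain ⟨z, hz, rfl⟩ := exists_integers_of_mem_unitDomain h
  have hp' := not_isUnit_natCast_integers hp
  have hunit : ∀ s, 1 ≤ s → IsUnit (hwMatrix (rootPoly z) (p ^ e) q g s).det :=
    fun _ hs => isUnit_det_hwMatrix ha hp' (natDegree_rootPoly_le z) hz hs
  rw [nrowAt_map _ (hunit s (hr.trans hrs)), nrowAt_map _ (hunit r hr),
    pi_norm_le_iff_of_nonneg (by positivity)]
  exact fun u => norm_le_pow_of_natCast_pow_dvd (dvd_nrowAt_sub_nrowAt ha hp' hz hr hrs hk u)

variable [CompleteSpace K]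

/-- The limit of the normalized rows `nrowAt`. -/
def limRow {n : ℕ} (P q g : ℕ) (k : Polynomial (MvPolynomial (Fin n) ℤ)) (a : Fin n → K) :
    Fin g → K :=
  limUnder atTop fun s => nrowAt P q g s k a

theorem exists_tendsto_of_norm_sub_le {E : Type*} [NormedAddCommGroup E] [CompleteSpace E]
    {c : ℝ} (hc0 : 0 ≤ c) (hc1 : c < 1) {x : ℕ → E}
    (h : ∀ r s, 1 ≤ r → r ≤ s → ‖x s - x r‖ ≤ c ^ r) : ∃ y, Tendsto x atTop (𝓝 y) := by
  refine cauchySeq_tendsto_of_complete (Metric.cauchySeq_iff'.2 fun ε hε => ?_)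
  obtain ⟨N, hN⟩ := exists_pow_lt_of_lt_one hε hc1
  refine ⟨N + 1, fun s hs => ?_⟩
  rw [dist_eq_norm]
  exact (h (N + 1) s (by omega) hs).trans_lt
    ((pow_le_pow_of_le_one hc0 hc1.le (Nat.le_succ N)).trans_lt hN)

variable {p e q g : ℕ} [Fact p.Prime] {a : Fin (q * g + 1) → K}
  {k : Polynomial (MvPolynomial (Fin (q * g + 1)) ℤ)}

theorem tendsto_nrowAt (ha : Admissible p e q g) (hp : ‖(p : K)‖ < 1)
    (h : a ∈ unitDomain K (p ^ e) q g) (hk : k.natDegree ≤ q * g + g) :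
    Tendsto (fun s => nrowAt (p ^ e) q g s k a) atTop (𝓝 (limRow (p ^ e) q g k a)) :=
  tendsto_nhds_limUnder (exists_tendsto_of_norm_sub_le (norm_nonneg _) hp fun _ _ hr hrs =>
    norm_nrowAt_sub_le ha hp h hr hrs hk)

theorem norm_limRow_sub_le (ha : Admissible p e q g) (hp : ‖(p : K)‖ < 1)
    (h : a ∈ unitDomain K (p ^ e) q g) {r : ℕ} (hr : 1 ≤ r) (hk : k.natDegree ≤ q * g + g) :
    ‖limRow (p ^ e) q g k a - nrowAt (p ^ e) q g r k a‖ ≤ ‖(p : K)‖ ^ r := by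
  refine le_of_tendsto ((tendsto_nrowAt ha hp h hk).sub_const _).norm ?_
  filter_upwards [eventually_ge_atTop r] with s hs
  exact norm_nrowAt_sub_le ha hp h hr hs hk

theorem tendstoUniformlyOn_nrowAt (ha : Admissible p e q g) (hp : ‖(p : K)‖ < 1)
    (hk : k.natDegree ≤ q * g + g) : TendstoUniformlyOn (fun s => nrowAt (p ^ e) q g s k)
      (limRow (p ^ e) q g k) atTop (unitDomain K (p ^ e) q g) := by
  rw [Metric.tendstoUniformlyOn_iff]
  intro ε hε
  have hlt :=
    (tendsto_pow_atTop_nhds_zero_of_lt_one (norm_nonneg (p : K)) hp).eventually_lt_const hε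
  filter_upwards [hlt, eventually_ge_atTop 1] with s hs hs1 a h
  rw [dist_eq_norm]
  exact (norm_limRow_sub_le ha hp h hs1 hk).trans_lt hs

theorem exists_tendsto_nrowAt_taylorPoint (ha : Admissible p e q g) (hp : ‖(p : K)‖ < 1)
    {z : Fin (q * g + 1) → integers K} (hz : IsUnit (hwMatrix (rootPoly z) (p ^ e) q g 1).det)
    (hk : k.natDegree ≤ q * g + g) (u : Fin g) :
    ∃ f, Tendsto (fun s => nrowAt (p ^ e) q g s k (taylorPoint z) u) atTop (𝓝 f) := by
  have hp' : ¬ IsUnit (p : MvPowerSeries (Fin (q * g + 1)) (integers K)) := by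
    rw [isUnit_iff_constantCoeff, map_natCast]
    exact not_isUnit_natCast_integers hp
  have hcoeff (d : Fin (q * g + 1) →₀ ℕ) : ∃ c, Tendsto
      (fun s => coeff d (nrowAt (p ^ e) q g s k (taylorPoint z) u)) atTop (𝓝 c) := by
    refine exists_tendsto_of_norm_sub_le (norm_nonneg _) hp fun r s hr hrs => ?_
    obtain ⟨w, hw⟩ := dvd_nrowAt_sub_nrowAt ha hp' (isUnit_det_taylorPoint hz) hr hrs hk u
    refine norm_le_pow_of_natCast_pow_dvd ⟨coeff d w, ?_⟩
    rw [← map_sub, hw, ← Nat.cast_pow, ← Nat.cast_pow, ← nsmul_eq_mul, ← nsmul_eq_mul, map_nsmul]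
  choose c hc using hcoeff
  exact ⟨c, (WithPiTopology.tendsto_iff_coeff_tendsto _ _ _).2 hc⟩

theorem exists_hasFPowerSeriesOnBall_limRow (ha : Admissible p e q g) (hp : ‖(p : K)‖ < 1)
    {z : Fin (q * g + 1) → integers K} (hz : IsUnit (hwMatrix (rootPoly z) (p ^ e) q g 1).det)
    (hk : k.natDegree ≤ q * g + g) : ∃ f : Fin g → MvPowerSeries (Fin (q * g + 1)) (integers K),
      ∀ u, Tendsto (fun s => nrowAt (p ^ e) q g s k (taylorPoint z) u) atTop (𝓝 (f u)) ∧
        HasFPowerSeriesOnBall (fun x => limRow (p ^ e) q g k x u) (formalSeries (f u))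
          ((integers K).subtype ∘ z) 1 := by
  choose f hf using exists_tendsto_nrowAt_taylorPoint ha hp hz hk
  refine ⟨f, fun u => ⟨hf u, hasFPowerSeriesOnBall_of_eq_aeval _ fun y hy => ?_⟩⟩
  refine congrFun (Tendsto.limUnder_eq (tendsto_pi_nhds.2 fun v => ?_) : _ =
    fun v => ((aeval (hasEval_integers hy) (f v) : integers K) : K)) u
  have hlim := (continuous_subtype_val.tendsto _).comp
    (((continuous_aeval (hasEval_integers hy)).tendsto _).comp (hf v))
  refine hlim.congr' ?_
  filter_upwards [eventually_ge_atTop 1] with s hs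
  exact (nrowAt_add_eq_aeval (isUnit_det_hwMatrix ha (not_isUnit_natCast_integers hp)
    (natDegree_rootPoly_le z) hz hs) k hy v).symm

theorem analyticAt_limRow (ha : Admissible p e q g) (hp : ‖(p : K)‖ < 1)
    (h : a ∈ unitDomain K (p ^ e) q g) (hk : k.natDegree ≤ q * g + g) :
    AnalyticAt K (limRow (p ^ e) q g k) a := by
  obtain ⟨z, hz, rfl⟩ := exists_integers_of_mem_unitDomain h
  obtain ⟨f, hf⟩ := exists_hasFPowerSeriesOnBall_limRow ha hp hz hk
  exact AnalyticAt.pi fun u => (hf u).2.analyticAt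

theorem differentiableAt_nrowAt (ha : Admissible p e q g) (hp : ‖(p : K)‖ < 1)
    (h : a ∈ unitDomain K (p ^ e) q g) {s : ℕ} (hs : 1 ≤ s)
    (k : Polynomial (MvPolynomial (Fin (q * g + 1)) ℤ)) :
    DifferentiableAt K (nrowAt (p ^ e) q g s k) a := by
  obtain ⟨z, hz, rfl⟩ := exists_integers_of_mem_unitDomain h
  have hdet :=
    isUnit_det_hwMatrix ha (not_isUnit_natCast_integers hp) (natDegree_rootPoly_le z) hz hs
  exact differentiableAt_pi.2 fun u =>
    (hasFPowerSeriesOnBall_nrowAt hdet k u).analyticAt.differentiableAt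

theorem tendsto_fderiv_nrowAt (ha : Admissible p e q g) (hp : ‖(p : K)‖ < 1)
    (h : a ∈ unitDomain K (p ^ e) q g) (hk : k.natDegree ≤ q * g + g) (i : Fin (q * g + 1)) :
    Tendsto (fun s => fderiv K (nrowAt (p ^ e) q g s k) a (Pi.single i 1)) atTop
      (𝓝 (fderiv K (limRow (p ^ e) q g k) a (Pi.single i 1))) := by
  obtain ⟨z, hz, rfl⟩ := exists_integers_of_mem_unitDomain h
  obtain ⟨f, hf⟩ := exists_hasFPowerSeriesOnBall_limRow ha hp hz hk
  refine tendsto_pi_nhds.2 fun u => ?_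
  have hlim := (continuous_subtype_val.tendsto _).comp
    ((WithPiTopology.tendsto_iff_coeff_tendsto _ _ _).1 (hf u).1 (Finsupp.single i 1))
  have hfderiv {F : (Fin (q * g + 1) → K) → Fin g → K} {b : Fin (q * g + 1) → K}
      (hF : DifferentiableAt K F b) :
      fderiv K F b (Pi.single i 1) u = fderiv K (fun x => F x u) b (Pi.single i 1) := by
    rw [fderiv_apply hF]
    rfl
  rw [hfderiv (analyticAt_limRow ha hp h hk).differentiableAt,
    fderiv_single_of_hasFPowerSeriesOnBall (hf u).2]
  refine hlim.congr' ?_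
  filter_upwards [eventually_ge_atTop 1] with s hs
  rw [hfderiv (differentiableAt_nrowAt ha hp h hs k), fderiv_single_of_hasFPowerSeriesOnBall
    (hasFPowerSeriesOnBall_nrowAt (isUnit_det_hwMatrix ha (not_isUnit_natCast_integers hp)
      (natDegree_rootPoly_le z) hz hs) k u)]
  rfl

end Limits

section Derivations

open Polynomial

variable {n : ℕ}

/-- The polynomial `t ^ w (t - z_1) ⋯ (t - z_n) / (t - z_i)` over `ℤ[z]`. -/
def cofactorMoment (i : Fin n) (w : ℕ) : (MvPolynomial (Fin n) ℤ)[X] :=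
  X ^ w * cofactorPoly MvPolynomial.X i

/-- The derivation `∂ / ∂ z_i` of `ℤ[z][t]`. -/
def polyDeriv (i : Fin n) : Derivation ℤ (MvPolynomial (Fin n) ℤ)[X] (MvPolynomial (Fin n) ℤ)[X] :=
  (PolynomialModule.equivPolynomialSelf (R := MvPolynomial (Fin n) ℤ)).toLinearMap.compDer
    (MvPolynomial.pderiv i).mapCoeffs

theorem coeff_polyDeriv (i : Fin n) (f : (MvPolynomial (Fin n) ℤ)[X]) (m : ℕ) :
    (polyDeriv i f).coeff m = MvPolynomial.pderiv i (f.coeff m) := rfl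

theorem polyDeriv_X (i : Fin n) : polyDeriv i X = 0 := by
  ext1 m
  rw [coeff_polyDeriv, coeff_X]
  split_ifs <;> simp

theorem polyDeriv_C (i : Fin n) (f : MvPolynomial (Fin n) ℤ) :
    polyDeriv i (C f) = C (MvPolynomial.pderiv i f) := by
  ext1 m
  rw [coeff_polyDeriv, coeff_C, coeff_C]
  split_ifs <;> simp

theorem polyDeriv_X_sub_C_self (i : Fin n) : polyDeriv i (X - C (MvPolynomial.X i)) = -1 := by
  rw [map_sub, polyDeriv_X, polyDeriv_C, MvPolynomial.pderiv_X_self, C_1, zero_sub]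

theorem polyDeriv_X_sub_C_of_ne {i j : Fin n} (hij : i ≠ j) :
    polyDeriv i (X - C (MvPolynomial.X j)) = 0 := by
  rw [map_sub, polyDeriv_X, polyDeriv_C, MvPolynomial.pderiv_X_of_ne hij.symm, C_0, sub_zero]

theorem polyDeriv_cofactorPoly_self (i : Fin n) :
    polyDeriv i (cofactorPoly MvPolynomial.X i) = 0 := by
  refine Finset.prod_induction _ (fun f => polyDeriv i f = 0) (fun f f' hf hf' => ?_)
    (Derivation.map_one_eq_zero _) fun j hj =>
      polyDeriv_X_sub_C_of_ne (Finset.ne_of_mem_erase hj).symm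
  rw [Derivation.leibniz, hf, hf', smul_zero, smul_zero, add_zero]

theorem polyDeriv_rootPoly (i : Fin n) :
    polyDeriv i (rootPoly MvPolynomial.X) = -cofactorPoly MvPolynomial.X i := by
  rw [← mul_cofactorPoly MvPolynomial.X i, Derivation.leibniz, polyDeriv_cofactorPoly_self,
    polyDeriv_X_sub_C_self, smul_zero, zero_add, smul_eq_mul]
  ring

theorem polyDeriv_rootPoly_pow (i : Fin n) (N : ℕ) :
    polyDeriv i (rootPoly MvPolynomial.X ^ N) = -((N : (MvPolynomial (Fin n) ℤ)[X]) *
      (cofactorPoly MvPolynomial.X i * rootPoly MvPolynomial.X ^ (N - 1))) := by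
  rw [Derivation.leibniz_pow, polyDeriv_rootPoly, nsmul_eq_mul, smul_eq_mul]
  ring

variable {P q g s : ℕ}

theorem pderiv_hwMatrix (hs : 0 < expo P q s) (i : Fin n) (u l : Fin g) :
    MvPolynomial.pderiv i (hwMatrix (rootPoly MvPolynomial.X) P q g s u l) =
      -((expo P q s : MvPolynomial (Fin n) ℤ) *
        row (rootPoly MvPolynomial.X) P q g s (cofactorMoment i u) l) := by
  rw [hwMatrix, Matrix.of_apply, row_apply, row_apply, ← coeff_polyDeriv, mul_assoc,
    mul_pow_sub_one hs.ne', Derivation.leibniz, polyDeriv_rootPoly_pow, Derivation.leibniz_pow,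
    polyDeriv_X, smul_zero, smul_zero, smul_zero, add_zero, ← coeff_natCast_mul, ← coeff_neg,
    cofactorMoment, smul_eq_mul]
  congr 1
  ring

theorem X_sub_C_mul_polyDeriv_cofactorPoly {i j : Fin n} (hij : i ≠ j) {N : ℕ} (hN : 0 < N) :
    (X - C (MvPolynomial.X j)) *
        polyDeriv i (cofactorPoly MvPolynomial.X j * rootPoly MvPolynomial.X ^ (N - 1)) =
      -((N : (MvPolynomial (Fin n) ℤ)[X]) *
        (cofactorPoly MvPolynomial.X i * rootPoly MvPolynomial.X ^ (N - 1))) := by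
  have h := Derivation.leibniz (polyDeriv i) (X - C (MvPolynomial.X j))
    (cofactorPoly MvPolynomial.X j * rootPoly MvPolynomial.X ^ (N - 1))
  rw [← mul_assoc, mul_cofactorPoly, mul_pow_sub_one hN.ne', polyDeriv_rootPoly_pow,
    polyDeriv_X_sub_C_of_ne hij, smul_zero, add_zero] at h
  exact h.symm

theorem sub_mul_polyDeriv_cofactorPoly {i j : Fin n} (hij : i ≠ j) {N : ℕ} (hN : 0 < N) :
    C (MvPolynomial.X i - MvPolynomial.X j) *
        polyDeriv i (cofactorPoly MvPolynomial.X j * rootPoly MvPolynomial.X ^ (N - 1)) =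
      -((N : (MvPolynomial (Fin n) ℤ)[X]) *
        (cofactorPoly MvPolynomial.X i * rootPoly MvPolynomial.X ^ (N - 1) -
          cofactorPoly MvPolynomial.X j * rootPoly MvPolynomial.X ^ (N - 1))) := by
  refine mul_left_cancel₀ (monic_X_sub_C (MvPolynomial.X j)).ne_zero ?_
  rw [mul_left_comm, X_sub_C_mul_polyDeriv_cofactorPoly hij hN]
  have hi := mul_cofactorPoly (MvPolynomial.X (R := ℤ)) i
  have hj := mul_cofactorPoly (MvPolynomial.X (R := ℤ)) j
  rw [C_sub]
  linear_combination (N : (MvPolynomial (Fin n) ℤ)[X]) * rootPoly MvPolynomial.X ^ (N - 1) *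
    (hi - hj)

theorem sub_mul_pderiv_row_cofactorPoly (hs : 0 < expo P q s) {i j : Fin n} (hij : i ≠ j)
    (l : Fin g) :
    (MvPolynomial.X i - MvPolynomial.X j) * MvPolynomial.pderiv i
        (row (rootPoly MvPolynomial.X) P q g s (cofactorPoly MvPolynomial.X j) l) =
      -((expo P q s : MvPolynomial (Fin n) ℤ) *
        (row (rootPoly MvPolynomial.X) P q g s (cofactorPoly MvPolynomial.X i) l -
          row (rootPoly MvPolynomial.X) P q g s (cofactorPoly MvPolynomial.X j) l)) := by
  simp only [row_apply]
  rw [← coeff_polyDeriv, ← coeff_C_mul, sub_mul_polyDeriv_cofactorPoly hij hs, coeff_neg,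
    coeff_natCast_mul, coeff_sub]

theorem derivative_rootPoly {R : Type*} [CommRing R] (z : Fin n → R) :
    derivative (rootPoly z) = ∑ j, cofactorPoly z j := by
  rw [rootPoly, derivative_prod_finset]
  simp only [derivative_X_sub_C, mul_one]
  rfl

end Derivations

section ExactForms

open Polynomial

/-- The map `r ↦ q F r' - F' r`, that is, `q F ^ (1 + 1 / q) d(r F ^ (-1 / q)) / dt`: its values
are the numerators of the exact differential forms on the curve `y ^ q = F(t)`. -/
def twistedDeriv {R : Type*} [CommRing R] (F : R[X]) (q : ℕ) : R[X] →ₗ[R] R[X] :=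
  LinearMap.mulLeft R ((q : R[X]) * F) ∘ₗ derivative - LinearMap.mulLeft R (derivative F)

variable {R S : Type*} [CommRing R] [CommRing S] {F : R[X]} {P q g : ℕ}

theorem twistedDeriv_apply (r : R[X]) :
    twistedDeriv F q r = (q : R[X]) * F * derivative r - derivative F * r := rfl

theorem twistedDeriv_one : twistedDeriv F q 1 = -derivative F := by
  rw [twistedDeriv_apply, derivative_one, mul_zero, mul_one, zero_sub]

theorem twistedDeriv_map (φ : R →+* S) (r : R[X]) :
    twistedDeriv (F.map φ) q (r.map φ) = (twistedDeriv F q r).map φ := by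
  simp only [twistedDeriv_apply, derivative_map, Polynomial.map_sub, Polynomial.map_mul,
    Polynomial.map_natCast]

theorem twistedDeriv_mul_pow (r : R[X]) {N : ℕ} (hN : 0 < N) :
    twistedDeriv F q r * F ^ (N - 1) = (q : R[X]) * derivative (r * F ^ N) -
      ((q * N + 1 : ℕ) : R[X]) * (derivative F * r * F ^ (N - 1)) := by
  rw [twistedDeriv_apply, derivative_mul, derivative_pow, ← mul_pow_sub_one hN.ne' F,
    C_eq_natCast]
  push_cast
  ring

theorem dvd_coeff_derivative {x : R} (f : R[X]) {m : ℕ} (hm : 0 < m) (hx : x ∣ m) :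
    x ∣ (derivative f).coeff (m - 1) := by
  rw [coeff_derivative, ← Nat.cast_add_one, Nat.sub_add_cancel hm]
  exact hx.mul_left _

theorem dvd_row_twistedDeriv (hP : 1 < P) (hq : q ∣ P - 1) {s : ℕ} (hs : 1 ≤ s) (r : R[X])
    (l : Fin g) : ((P ^ s : ℕ) : R) ∣ row F P q g s (twistedDeriv F q r) l := by
  have hpos : 0 < P ^ s := by positivity
  rw [row_apply, twistedDeriv_mul_pow r (expo_pos hP hq hs), mul_expo hq, Nat.sub_add_cancel hpos,
    coeff_sub, coeff_natCast_mul, coeff_natCast_mul]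
  refine dvd_sub (Dvd.dvd.mul_left (dvd_coeff_derivative _ (by positivity) ?_) _)
    (dvd_mul_right _ _)
  exact Nat.cast_dvd_cast (Nat.dvd_mul_left _ _)

theorem dvd_nrow_twistedDeriv (hP : 1 < P) (hq : q ∣ P - 1) {s : ℕ} (hs : 1 ≤ s) (r : R[X])
    (l : Fin g) : ((P ^ s : ℕ) : R) ∣ nrow F P q g s (twistedDeriv F q r) l :=
  dvd_vecMul (dvd_row_twistedDeriv hP hq hs r) _ l

variable {K : Type*} [NontriviallyNormedField K] [IsUltrametricDist K]

theorem exists_smul_eq_map_integers (r : K[X]) :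
    ∃ x : K, x ≠ 0 ∧ ∃ r₀ : (integers K)[X], r₀.map (integers K).subtype = x • r := by
  obtain ⟨B, hB⟩ : ∃ B : ℝ, ∀ m, ‖r.coeff m‖ ≤ B := by
    obtain ⟨B, hB⟩ := (r.support.finite_toSet.image fun m => ‖r.coeff m‖).bddAbove
    refine ⟨max B 0, fun m => ?_⟩
    by_cases hm : m ∈ r.support
    · exact (hB ⟨m, hm, rfl⟩).trans (le_max_left _ _)
    · rw [notMem_support_iff.1 hm, norm_zero]
      exact le_max_right _ _
  have hB0 : 0 < B + 1 := by linarith [(norm_nonneg _).trans (hB 0)]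
  obtain ⟨x, hx0, hx⟩ := NormedField.exists_norm_lt K (inv_pos.2 hB0)
  refine ⟨x, norm_pos_iff.1 hx0, ?_⟩
  have hlifts : x • r ∈ lifts (integers K).subtype := by
    refine (lifts_iff_coeff_lifts _).2 fun m => ⟨⟨(x • r).coeff m, ?_⟩, rfl⟩
    change ‖(x • r).coeff m‖ ≤ 1
    rw [coeff_smul, smul_eq_mul, norm_mul, ← inv_mul_cancel₀ hB0.ne']
    gcongr
    linarith [hB m]
  exact (mem_lifts _).1 hlifts

variable {p e : ℕ} [Fact p.Prime] {a : Fin (q * g + 1) → K}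

theorem norm_nrow_twistedDeriv_map_le (ha : Admissible p e q g) (hp : ‖(p : K)‖ < 1)
    (h : a ∈ unitDomain K (p ^ e) q g) {s : ℕ} (hs : 1 ≤ s) (r : (integers K)[X]) :
    ‖nrow (rootPoly a) (p ^ e) q g s
      (twistedDeriv (rootPoly a) q (r.map (integers K).subtype))‖ ≤ ‖(p : K)‖ ^ s := by
  obtain ⟨z, hz, rfl⟩ := exists_integers_of_mem_unitDomain h
  rw [← map_rootPoly, twistedDeriv_map, nrow_map _ (isUnit_det_hwMatrix ha
    (not_isUnit_natCast_integers hp) (natDegree_rootPoly_le z) hz hs),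
    pi_norm_le_iff_of_nonneg (by positivity)]
  refine fun u => norm_le_pow_of_natCast_pow_dvd (Dvd.dvd.trans ?_
    (dvd_nrow_twistedDeriv ha.one_lt ha.dvd hs r u))
  rw [← pow_mul, Nat.cast_pow]
  exact pow_dvd_pow _ (Nat.le_mul_of_pos_left s ha.e_pos)

theorem tendsto_nrow_twistedDeriv (ha : Admissible p e q g) (hp : ‖(p : K)‖ < 1)
    (h : a ∈ unitDomain K (p ^ e) q g) (r : K[X]) :
    Tendsto (fun s => nrow (rootPoly a) (p ^ e) q g s (twistedDeriv (rootPoly a) q r))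
      atTop (𝓝 0) := by
  obtain ⟨x, hx, r₀, hr₀⟩ := exists_smul_eq_map_integers r
  have hbound : ∀ᶠ s in atTop, ‖nrow (rootPoly a) (p ^ e) q g s
      (twistedDeriv (rootPoly a) q (x • r))‖ ≤ ‖(p : K)‖ ^ s := by
    filter_upwards [eventually_ge_atTop 1] with s hs
    exact hr₀ ▸ norm_nrow_twistedDeriv_map_le ha hp h hs r₀
  have hlim := (squeeze_zero_norm' hbound
    (tendsto_pow_atTop_nhds_zero_of_lt_one (norm_nonneg _) hp)).const_smul x⁻¹
  simpa only [map_smul, inv_smul_smul₀ hx, smul_zero] using hlim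

end ExactForms

section MatrixCalculus

open scoped Matrix Matrix.Norms.Elementwise

variable {K : Type*} [NontriviallyNormedField K] {E : Type*} [NormedAddCommGroup E]
  [NormedSpace K E] {m n : Type*} {M : E → Matrix m n K} {a : E}

theorem fderiv_matrix_apply [Finite n] (hM : DifferentiableAt K M a) (w : E) (i : m) (j : n) :
    fderiv K M a w i j = fderiv K (fun x => M x i j) a w := by
  have := Fintype.ofFinite n
  rw [fderiv_apply (differentiableAt_pi.1 hM i), fderiv_apply hM]
  rfl

theorem fderiv_vecMul [CompleteSpace K] [Fintype m] [Finite n] {v : E → m → K}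
    (hv : DifferentiableAt K v a) (hM : DifferentiableAt K M a) (w : E) :
    fderiv K (fun x => v x ᵥ* M x) a w = v a ᵥ* fderiv K M a w + fderiv K v a w ᵥ* M a := by
  have := Fintype.ofFinite n
  exact DFunLike.congr_fun (ContinuousLinearMap.fderiv_of_bilinear
    (Matrix.vecMulBilin K K : (m → K) →ₗ[K] Matrix m n K →ₗ[K] n → K).toContinuousBilinearMap
    hv hM) w

theorem fderiv_mulVec [CompleteSpace K] [Finite m] [Fintype n] {c : E → n → K}
    (hM : DifferentiableAt K M a) (hc : DifferentiableAt K c a) (w : E) :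
    fderiv K (fun x => M x *ᵥ c x) a w = M a *ᵥ fderiv K c a w + fderiv K M a w *ᵥ c a := by
  have := Fintype.ofFinite m
  exact DFunLike.congr_fun (ContinuousLinearMap.fderiv_of_bilinear
    (Matrix.mulVecBilin K K : Matrix m n K →ₗ[K] (n → K) →ₗ[K] m → K).toContinuousBilinearMap
    hM hc) w

variable [Fintype n]

theorem analyticAt_det [DecidableEq n] {M : E → Matrix n n K} (hM : AnalyticAt K M a) :
    AnalyticAt K (fun x => (M x).det) a := by
  have hentry (i j : n) : AnalyticAt K (fun x => M x i j) a :=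
    analyticAt_pi_iff.1 (analyticAt_pi_iff.1 hM i) j
  simp only [Matrix.det_apply, Units.smul_def, zsmul_eq_mul]
  exact Finset.analyticAt_fun_sum _ fun σ _ => analyticAt_const.mul
    (Finset.analyticAt_fun_prod _ fun i _ => hentry _ _)

theorem analyticAt_nonsing_inv [DecidableEq n] {M : E → Matrix n n K} (hM : AnalyticAt K M a)
    (hdet : (M a).det ≠ 0) : AnalyticAt K (fun x => (M x)⁻¹) a := by
  refine AnalyticAt.pi fun i => AnalyticAt.pi fun j => ?_
  simp only [Matrix.inv_def, Matrix.smul_apply, Matrix.adjugate_apply, Ring.inverse_eq_inv',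
    smul_eq_mul]
  refine ((analyticAt_det hM).inv hdet).mul (analyticAt_det ?_)
  refine AnalyticAt.pi fun k => AnalyticAt.pi fun l => ?_
  simp only [Matrix.updateRow_apply]
  split_ifs
  · exact analyticAt_const
  · exact analyticAt_pi_iff.1 (analyticAt_pi_iff.1 hM k) l

variable [CompleteSpace K] [Fintype m]

theorem analyticAt_mulVec {c : E → n → K} (hM : AnalyticAt K M a) (hc : AnalyticAt K c a) :
    AnalyticAt K (fun x => M x *ᵥ c x) a :=
  ((Matrix.mulVecBilin K K : Matrix m n K →ₗ[K] (n → K) →ₗ[K] m →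
    K).toContinuousBilinearMap.analyticAt_bilinear (M a, c a)).comp₂ hM hc

theorem exists_analyticAt_eventuallyEq_mulVec [DecidableEq n] (hM : AnalyticAt K M a)
    {N : Matrix n m K} (hN : N * M a = 1) {v : E → m → K} (hv : AnalyticAt K v a)
    (hrange : ∀ᶠ x in 𝓝 a, ∃ c, v x = M x *ᵥ c) :
    ∃ c : E → n → K, AnalyticAt K c a ∧ v =ᶠ[𝓝 a] fun x => M x *ᵥ c x := by
  have hNM : AnalyticAt K (fun x => N * M x) a :=
    ((mulLeftLinearMap n K N).toContinuousLinearMap.analyticAt _).comp hM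
  have hdet : (N * M a).det ≠ 0 := by
    rw [hN, Matrix.det_one]
    exact one_ne_zero
  refine ⟨fun x => (N * M x)⁻¹ *ᵥ (N *ᵥ v x), analyticAt_mulVec (analyticAt_nonsing_inv hNM hdet)
    (analyticAt_mulVec analyticAt_const hv), ?_⟩
  filter_upwards [hrange, (analyticAt_det hNM).continuousAt.eventually_ne hdet] with x hx hdetx
  obtain ⟨c, hc⟩ := hx
  rw [hc, Matrix.mulVec_mulVec _ N, Matrix.mulVec_mulVec _ (N * M x)⁻¹,
    Matrix.nonsing_inv_mul _ (isUnit_iff_ne_zero.2 hdetx), Matrix.one_mulVec]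

end MatrixCalculus

section Evaluation

open scoped Matrix Matrix.Norms.Elementwise

variable {K : Type*} [NontriviallyNormedField K] {n P q g s : ℕ}

theorem differentiableAt_spec (f : MvPolynomial (Fin n) ℤ) (a : Fin n → K) :
    DifferentiableAt K (fun x => spec x f) a :=
  (AnalyticAt.aeval_mvPolynomial (fun i => (ContinuousLinearMap.proj (R := K)
    (φ := fun _ : Fin n => K) i).analyticAt a) f).differentiableAt

theorem fderiv_spec (f : MvPolynomial (Fin n) ℤ) (a : Fin n → K) (i : Fin n) :
    fderiv K (fun x => spec x f) a (Pi.single i 1) = spec a (MvPolynomial.pderiv i f) := by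
  induction f using MvPolynomial.induction_on with
  | C m => simp
  | add f f' hf hf' =>
    simp only [map_add]
    rw [fderiv_fun_add (differentiableAt_spec f a) (differentiableAt_spec f' a), _root_.add_apply,
      hf, hf']
  | mul_X f j hf =>
    have hX : HasFDerivAt (fun x : Fin n → K => x j)
        (ContinuousLinearMap.proj (R := K) (φ := fun _ : Fin n => K) j) a :=
      (ContinuousLinearMap.proj (R := K) (φ := fun _ : Fin n => K) j).hasFDerivAt
    simp only [map_mul, spec_X]
    rw [((differentiableAt_spec f a).hasFDerivAt.fun_mul hX).fderiv, Derivation.leibniz,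
      MvPolynomial.pderiv_X]
    simp only [_root_.add_apply, _root_.smul_apply, hf, map_add, smul_eq_mul, map_mul, spec_X,
      ContinuousLinearMap.proj_apply, Pi.single_apply]
    split_ifs <;> simp

theorem spec_comp_row {R : Type*} [CommRing R] (z : Fin n → R)
    (k : Polynomial (MvPolynomial (Fin n) ℤ)) :
    spec z ∘ row (rootPoly MvPolynomial.X) P q g s k =
      row (rootPoly z) P q g s (k.map (spec z)) := by
  rw [← row_map, map_spec_rootPoly]

theorem differentiableAt_row (k : Polynomial (MvPolynomial (Fin n) ℤ)) (a : Fin n → K) :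
    DifferentiableAt K (fun x => row (rootPoly x) P q g s (k.map (spec x))) a := by
  simp only [← spec_comp_row]
  exact differentiableAt_pi.2 fun l => differentiableAt_spec _ a

theorem fderiv_row (k : Polynomial (MvPolynomial (Fin n) ℤ)) (a : Fin n → K) (i : Fin n) :
    fderiv K (fun x => row (rootPoly x) P q g s (k.map (spec x))) a (Pi.single i 1) =
      fun l => spec a (MvPolynomial.pderiv i (row (rootPoly MvPolynomial.X) P q g s k l)) := by
  ext l
  have happly := fderiv_apply (differentiableAt_row (P := P) (q := q) (g := g) (s := s) k a) l
  simp only [← spec_comp_row] at happly ⊢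
  rw [← fderiv_spec]
  exact (DFunLike.congr_fun happly _).symm

theorem differentiableAt_hwMatrix (a : Fin n → K) :
    DifferentiableAt K (fun x => hwMatrix (rootPoly x) P q g s) a :=
  differentiableAt_pi.2 fun u => by
    have h := differentiableAt_row (P := P) (q := q) (g := g) (s := s)
      (Polynomial.X ^ (u : ℕ) * rootPoly MvPolynomial.X) a
    simp only [Polynomial.map_mul, Polynomial.map_pow, Polynomial.map_X, map_spec_rootPoly] at h
    exact h

theorem fderiv_hwMatrix (hs : 0 < expo P q s) (a : Fin n → K) (i : Fin n) :
    fderiv K (fun x => hwMatrix (rootPoly x) P q g s) a (Pi.single i 1) =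
      -((expo P q s : K) • Matrix.of fun u : Fin g =>
        row (rootPoly a) P q g s ((cofactorMoment i u).map (spec a))) := by
  ext u l
  have hentry (x : Fin n → K) : hwMatrix (rootPoly x) P q g s u l =
      spec x (hwMatrix (rootPoly MvPolynomial.X) P q g s u l) := by
    rw [← map_spec_rootPoly, hwMatrix_map, Matrix.map_apply]
  rw [fderiv_matrix_apply (differentiableAt_hwMatrix a)]
  simp only [hentry]
  rw [fderiv_spec, pderiv_hwMatrix hs, map_neg, map_mul, map_natCast, Matrix.neg_apply,
    Matrix.smul_apply, Matrix.of_apply, ← spec_comp_row]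
  rfl

end Evaluation

section Connection

open scoped Matrix Matrix.Norms.Elementwise

variable {p e q g : ℕ}

theorem spec_pderiv_row_cofactorPoly {L : Type*} [Field L] {n P s : ℕ}
    (hs : 0 < expo P q s) {a : Fin n → L} {i j : Fin n}
    (haij : a i ≠ a j) :
    (fun l : Fin g => spec a (MvPolynomial.pderiv i (row (rootPoly MvPolynomial.X) P q g s
      (cofactorPoly MvPolynomial.X j) l))) = -((expo P q s : L) • (a i - a j)⁻¹ •
        (row (rootPoly a) P q g s (cofactorPoly a i) -
          row (rootPoly a) P q g s (cofactorPoly a j))) := by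
  have hij : i ≠ j := fun hij => haij (congrArg a hij)
  ext l
  have hspec := congrArg (spec a) (sub_mul_pderiv_row_cofactorPoly (g := g) hs hij l)
  have hrow (i : Fin n) : spec a (row (rootPoly MvPolynomial.X) P q g s
      (cofactorPoly MvPolynomial.X i) l) =
        row (rootPoly a) P q g s (cofactorPoly a i) l := by
    rw [← map_spec_cofactorPoly a, ← spec_comp_row]
    rfl
  simp only [map_mul, map_sub, map_neg, spec_X, map_natCast, hrow] at hspec
  rw [← eq_inv_mul_iff_mul_eq₀ (sub_ne_zero.2 haij)] at hspec
  rw [hspec]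
  simp only [Pi.neg_apply, Pi.smul_apply, Pi.sub_apply, smul_eq_mul]
  ring

variable {K : Type*} [NontriviallyNormedField K]

theorem Admissible.q_pos [Fact p.Prime] (ha : Admissible p e q g) : 0 < q :=
  pos_of_dvd_sub_one ha.one_lt ha.dvd

theorem tendsto_expo [CharZero K] [Fact p.Prime] (ha : Admissible p e q g)
    (hp : ‖(p : K)‖ < 1) :
    Tendsto (fun s => (expo (p ^ e) q s : K)) atTop (𝓝 (-(q : K)⁻¹)) := by
  have hq : (q : K) ≠ 0 := Nat.cast_ne_zero.2 ha.q_pos.ne'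
  have hexpo (s : ℕ) : (expo (p ^ e) q s : K) = (q : K)⁻¹ * ((((p : K) ^ e) ^ s) - 1) := by
    rw [eq_inv_mul_iff_mul_eq₀ hq, ← Nat.cast_mul, mul_expo ha.dvd,
      Nat.cast_sub (Nat.one_le_pow _ _ (zero_lt_one.trans ha.one_lt)), Nat.cast_pow, Nat.cast_pow,
      Nat.cast_one]
  have hpow : ‖(p : K) ^ e‖ < 1 := by
    rw [norm_pow]
    exact pow_lt_one₀ (norm_nonneg _) hp (Nat.one_le_iff_ne_zero.1 ha.e_pos)
  simpa [hexpo] using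
    ((tendsto_pow_atTop_nhds_zero_of_norm_lt_one hpow).sub_const 1).const_mul (q : K)⁻¹

theorem natDegree_cofactorPoly_X_le (i : Fin (q * g + 1)) :
    (cofactorPoly (MvPolynomial.X (R := ℤ)) i).natDegree ≤ q * g + g :=
  (natDegree_cofactorPoly_le _ i).trans (by omega)

theorem natDegree_cofactorMoment_le (i : Fin (q * g + 1)) (w : Fin g) :
    (cofactorMoment i w).natDegree ≤ q * g + g :=
  natDegree_X_pow_mul_le ((natDegree_cofactorPoly_le _ i).trans (by omega)) w

variable [IsUltrametricDist K] [CompleteSpace K] [Fact p.Prime] {a : Fin (q * g + 1) → K}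

theorem fderiv_nrowAt_vecMul (ha : Admissible p e q g) (hp : ‖(p : K)‖ < 1)
    (h : a ∈ unitDomain K (p ^ e) q g) {s : ℕ} (hs : 1 ≤ s)
    (k : Polynomial (MvPolynomial (Fin (q * g + 1)) ℤ)) (i : Fin (q * g + 1)) :
    fderiv K (nrowAt (p ^ e) q g s k) a (Pi.single i 1) ᵥ* hwMatrix (rootPoly a) (p ^ e) q g s =
      (fun l => spec a (MvPolynomial.pderiv i (row (rootPoly MvPolynomial.X) (p ^ e) q g s k l))) +
        (expo (p ^ e) q s : K) • nrowAt (p ^ e) q g s k a ᵥ* Matrix.of fun w : Fin g =>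
          row (rootPoly a) (p ^ e) q g s ((cofactorMoment i w).map (spec a)) := by
  have hrow : (fun x => nrowAt (p ^ e) q g s k x ᵥ* hwMatrix (rootPoly x) (p ^ e) q g s) =ᶠ[𝓝 a]
      fun x => row (rootPoly x) (p ^ e) q g s (k.map (spec x)) := by
    filter_upwards [eventually_mem_unitDomain h] with x hx
    exact nrow_vecMul_hwMatrix (isUnit_det_hwMatrix_of_mem ha hp hx hs) _
  have hderiv := DFunLike.congr_fun (hrow.fderiv_eq (𝕜 := K)) (Pi.single i 1)
  rw [fderiv_row, fderiv_vecMul (differentiableAt_nrowAt ha hp h hs k)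
    (differentiableAt_hwMatrix a), fderiv_hwMatrix (expo_pos ha.one_lt ha.dvd hs),
    Matrix.vecMul_neg, Matrix.vecMul_smul] at hderiv
  rw [← hderiv]
  abel

theorem fderiv_nrowAt_cofactorPoly (ha : Admissible p e q g) (hp : ‖(p : K)‖ < 1)
    (h : a ∈ unitDomain K (p ^ e) q g) {s : ℕ} (hs : 1 ≤ s) {i j : Fin (q * g + 1)}
    (haij : a i ≠ a j) :
    fderiv K (nrowAt (p ^ e) q g s (cofactorPoly MvPolynomial.X j)) a (Pi.single i 1) =
      (expo (p ^ e) q s : K) • (nrowAt (p ^ e) q g s (cofactorPoly MvPolynomial.X j) a ᵥ*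
          Matrix.of (fun w : Fin g => nrowAt (p ^ e) q g s (cofactorMoment i w) a) -
        (a i - a j)⁻¹ • (nrowAt (p ^ e) q g s (cofactorPoly MvPolynomial.X i) a -
          nrowAt (p ^ e) q g s (cofactorPoly MvPolynomial.X j) a)) := by
  have hdet := isUnit_det_hwMatrix_of_mem ha hp h hs
  refine Matrix.vecMul_injective_of_isUnit ((Matrix.isUnit_iff_isUnit_det _).2 hdet) ?_
  have hnrow (k) : nrowAt (p ^ e) q g s k a ᵥ* hwMatrix (rootPoly a) (p ^ e) q g s =
      row (rootPoly a) (p ^ e) q g s (k.map (spec a)) := nrow_vecMul_hwMatrix hdet _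
  have hmoment : Matrix.of (fun w : Fin g => nrowAt (p ^ e) q g s (cofactorMoment i w) a) *
      hwMatrix (rootPoly a) (p ^ e) q g s = Matrix.of fun w : Fin g =>
        row (rootPoly a) (p ^ e) q g s ((cofactorMoment i w).map (spec a)) := by
    refine Matrix.ext_row fun w => ?_
    exact hnrow _
  simp only [fderiv_nrowAt_vecMul ha hp h hs, Matrix.smul_vecMul, Matrix.sub_vecMul, hnrow,
    Matrix.vecMul_vecMul, hmoment, map_spec_cofactorPoly,
    spec_pderiv_row_cofactorPoly (expo_pos ha.one_lt ha.dvd hs) haij]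
  rw [neg_add_eq_sub, ← smul_sub]

/-- The matrix `C_i` with `∇_i 𝓘 = -q⁻¹ 𝓘 C_i`, whose rows are the limits of the normalized rows of
the differential forms `t ^ w Φ / (t - z_i) dt`. -/
def connMatrix (P q g : ℕ) (i : Fin (q * g + 1)) (a : Fin (q * g + 1) → K) :
    Matrix (Fin g) (Fin g) K :=
  Matrix.of fun w => limRow P q g (cofactorMoment i w) a

/-- The limit `𝓘(a)` of the matrices of normalized solutions. -/
def limFrame (P q g : ℕ) (a : Fin (q * g + 1) → K) : Matrix (Fin (q * g + 1)) (Fin g) K :=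
  Matrix.of fun j => limRow P q g (cofactorPoly MvPolynomial.X j) a

theorem analyticAt_connMatrix (ha : Admissible p e q g) (hp : ‖(p : K)‖ < 1)
    (h : a ∈ unitDomain K (p ^ e) q g) (i : Fin (q * g + 1)) :
    AnalyticAt K (connMatrix (p ^ e) q g i) a :=
  AnalyticAt.pi fun w => analyticAt_limRow ha hp h (natDegree_cofactorMoment_le i w)

theorem analyticAt_limFrame (ha : Admissible p e q g) (hp : ‖(p : K)‖ < 1)
    (h : a ∈ unitDomain K (p ^ e) q g) : AnalyticAt K (limFrame (p ^ e) q g) a :=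
  AnalyticAt.pi fun j => analyticAt_limRow ha hp h (natDegree_cofactorPoly_X_le j)

theorem fderiv_limFrame_apply_of_ne [CharZero K] (ha : Admissible p e q g) (hp : ‖(p : K)‖ < 1)
    (h : a ∈ unitDomain K (p ^ e) q g) {i j : Fin (q * g + 1)} (haij : a i ≠ a j) :
    fderiv K (limFrame (p ^ e) q g) a (Pi.single i 1) j =
      (q : K)⁻¹ • ((a i - a j)⁻¹ • (limFrame (p ^ e) q g a i - limFrame (p ^ e) q g a j) -
        (limFrame (p ^ e) q g a * connMatrix (p ^ e) q g i a) j) := by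
  have hcofactor (j) := tendsto_nrowAt ha hp h (natDegree_cofactorPoly_X_le j)
  have hmoment := tendsto_pi_nhds.2 fun w =>
    tendsto_nrowAt ha hp h (natDegree_cofactorMoment_le i w)
  have hlim := (tendsto_expo ha hp).smul
    ((((continuous_fst.matrix_vecMul continuous_snd).tendsto _).comp
      ((hcofactor j).prodMk_nhds hmoment)).sub
        (((hcofactor i).sub (hcofactor j)).const_smul (a i - a j)⁻¹))
  have hderiv : Tendsto (fun s => fderiv K (nrowAt (p ^ e) q g s (cofactorPoly MvPolynomial.X j)) a
      (Pi.single i 1)) atTop (𝓝 (fderiv K (limFrame (p ^ e) q g) a (Pi.single i 1) j)) := by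
    have happly := fderiv_apply (analyticAt_limFrame ha hp h).differentiableAt j
    have hlimRow := tendsto_fderiv_nrowAt ha hp h (natDegree_cofactorPoly_X_le j) i
    rwa [← show fderiv K (limRow (p ^ e) q g (cofactorPoly MvPolynomial.X j)) a (Pi.single i 1) =
      fderiv K (limFrame (p ^ e) q g) a (Pi.single i 1) j from DFunLike.congr_fun happly _]
  refine (tendsto_nhds_unique hderiv (hlim.congr' ?_)).trans ?_
  · filter_upwards [eventually_ge_atTop 1] with s hs
    exact (fderiv_nrowAt_cofactorPoly ha hp h hs haij).symm
  · rw [Matrix.mul_apply_eq_vecMul, ← neg_sub, neg_smul, smul_neg, neg_neg]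
    rfl

theorem sum_limRow_cofactorPoly (ha : Admissible p e q g) (hp : ‖(p : K)‖ < 1)
    (h : a ∈ unitDomain K (p ^ e) q g) :
    ∑ j, limRow (p ^ e) q g (cofactorPoly MvPolynomial.X j) a = 0 := by
  refine tendsto_nhds_unique (tendsto_finsetSum _ fun j _ =>
    tendsto_nrowAt ha hp h (natDegree_cofactorPoly_X_le j)) ?_
  have hexact := (tendsto_nrow_twistedDeriv ha hp h 1).neg
  simpa only [twistedDeriv_one, derivative_rootPoly, map_neg, neg_neg, map_sum, neg_zero, nrowAt,
    map_spec_cofactorPoly] using hexact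

theorem one_vecMul_limFrame (ha : Admissible p e q g) (hp : ‖(p : K)‖ < 1)
    (h : a ∈ unitDomain K (p ^ e) q g) : 1 ᵥ* limFrame (p ^ e) q g a = 0 := by
  rw [Matrix.one_vecMul]
  exact sum_limRow_cofactorPoly ha hp h

end Connection

section Gaudin

open scoped Matrix

variable {K : Type*} [NontriviallyNormedField K] {n : ℕ}

theorem one_vecMul_Omega (i j : Fin n) : 1 ᵥ* Omega K i j = 0 := by
  ext k
  simp [Omega, Matrix.vecMul, dotProduct, Finset.sum_add_distrib, Finset.sum_sub_distrib,
    Matrix.single_apply, ite_and]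

theorem one_vecMul_gaudin (q : ℕ) (i : Fin n) (z : Fin n → K) : 1 ᵥ* gaudin q i z = 0 := by
  simp only [gaudin, Matrix.vecMul_smul, Matrix.vecMul_sum, one_vecMul_Omega, smul_zero,
    Finset.sum_const_zero]

theorem gaudin_row_of_ne (q : ℕ) {i j : Fin n} (hij : i ≠ j) (z : Fin n → K) :
    gaudin q i z j = (q : K)⁻¹ • (z i - z j)⁻¹ • (Pi.single i 1 - Pi.single j 1) := by
  ext k
  rw [gaudin, Matrix.smul_apply, Matrix.sum_apply, Finset.sum_eq_single_of_mem j
    (Finset.mem_erase.2 ⟨hij.symm, Finset.mem_univ _⟩)]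
  · simp [Omega, Matrix.single_apply, Pi.single_apply, hij, eq_comm]
  · intro l _ hlj
    simp [Omega, hij, hlj]

theorem gaudin_mul_row_of_ne (q : ℕ) {i j : Fin n} (hij : i ≠ j) (z : Fin n → K) {m : Type*}
    (M : Matrix (Fin n) m K) :
    (gaudin q i z * M) j = (q : K)⁻¹ • (z i - z j)⁻¹ • (M i - M j) := by
  rw [Matrix.mul_apply_eq_vecMul, gaudin_row_of_ne q hij, Matrix.smul_vecMul, Matrix.smul_vecMul,
    Matrix.sub_vecMul, Matrix.single_one_vecMul, Matrix.single_one_vecMul]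
  rfl

theorem matrix_eq_of_one_vecMul_eq {R ι m : Type*} [Ring R] [Fintype ι]
    {A B : Matrix ι m R} (i : ι) (h : ∀ j, i ≠ j → A j = B j) (hsum : 1 ᵥ* A = 1 ᵥ* B) :
    A = B := by
  classical
  have hrow : A i = B i := by
    rw [Matrix.one_vecMul, Matrix.one_vecMul,
      ← Finset.add_sum_erase Finset.univ (fun j => A j) (Finset.mem_univ i),
      ← Finset.add_sum_erase Finset.univ (fun j => B j) (Finset.mem_univ i),
      Finset.sum_congr rfl fun j hj => h j (Finset.ne_of_mem_erase hj).symm] at hsum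
    exact add_right_cancel hsum
  refine Matrix.ext_row fun j => ?_
  obtain rfl | hij := eq_or_ne i j
  · exact hrow
  · exact h j hij

end Gaudin

section Invariance

open scoped Matrix Matrix.Norms.Elementwise

variable {K : Type*} [NontriviallyNormedField K] [IsUltrametricDist K] [CompleteSpace K]
  {p e q g : ℕ} [Fact p.Prime] {a : Fin (q * g + 1) → K}

/-- The coefficients of `∇_i s` for a section `s = 𝓘 c`. -/
def covDeriv (P q g : ℕ) (i : Fin (q * g + 1)) (c : (Fin (q * g + 1) → K) → Fin g → K)
    (z : Fin (q * g + 1) → K) : Fin g → K :=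
  fderiv K c z (Pi.single i 1) - (q : K)⁻¹ • (connMatrix P q g i z *ᵥ c z)

theorem analyticAt_covDeriv (ha : Admissible p e q g) (hp : ‖(p : K)‖ < 1)
    (h : a ∈ unitDomain K (p ^ e) q g) (i : Fin (q * g + 1))
    {c : (Fin (q * g + 1) → K) → Fin g → K} (hc : AnalyticAt K c a) :
    AnalyticAt K (covDeriv (p ^ e) q g i c) a := by
  have hderiv : AnalyticAt K (fun z => fderiv K c z (Pi.single i 1)) a :=
    ((ContinuousLinearMap.apply K (Fin g → K) (Pi.single i 1 : Fin (q * g + 1) → K)).analyticAt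
      _).comp hc.fderiv
  exact hderiv.sub ((analyticAt_mulVec (analyticAt_connMatrix ha hp h i) hc).fun_const_smul
    (c := (q : K)⁻¹))

theorem one_vecMul_fderiv_limFrame (ha : Admissible p e q g) (hp : ‖(p : K)‖ < 1)
    (h : a ∈ unitDomain K (p ^ e) q g) (w : Fin (q * g + 1) → K) :
    1 ᵥ* fderiv K (limFrame (p ^ e) q g) a w = 0 := by
  have hzero : (fun x => 1 ᵥ* limFrame (p ^ e) q g x) =ᶠ[𝓝 a] fun _ => 0 := by
    filter_upwards [eventually_mem_unitDomain h] with x hx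
    exact one_vecMul_limFrame ha hp hx
  have hderiv := fderiv_vecMul (differentiableAt_const 1)
    (analyticAt_limFrame ha hp h).differentiableAt w
  rw [hzero.fderiv_eq] at hderiv
  simpa using hderiv.symm

theorem fderiv_limFrame [CharZero K] (ha : Admissible p e q g) (hp : ‖(p : K)‖ < 1)
    (h : a ∈ unitDomain K (p ^ e) q g) (hinj : Function.Injective a) (i : Fin (q * g + 1)) :
    fderiv K (limFrame (p ^ e) q g) a (Pi.single i 1) = gaudin q i a * limFrame (p ^ e) q g a -
      (q : K)⁻¹ • (limFrame (p ^ e) q g a * connMatrix (p ^ e) q g i a) := by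
  refine matrix_eq_of_one_vecMul_eq i (fun j hij => ?_) ?_
  · rw [fderiv_limFrame_apply_of_ne ha hp h (hinj.ne hij), smul_sub, ← gaudin_mul_row_of_ne q hij]
    rfl
  · rw [one_vecMul_fderiv_limFrame ha hp h, Matrix.vecMul_sub, Matrix.vecMul_smul,
      ← Matrix.vecMul_vecMul, ← Matrix.vecMul_vecMul, one_vecMul_gaudin,
      one_vecMul_limFrame ha hp h]
    simp

theorem nablaKZ_eq [CharZero K] (ha : Admissible p e q g) (hp : ‖(p : K)‖ < 1)
    (h : a ∈ unitDomain K (p ^ e) q g) (hinj : Function.Injective a) (i : Fin (q * g + 1))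
    {s : (Fin (q * g + 1) → K) → Fin (q * g + 1) → K}
    {c : (Fin (q * g + 1) → K) → Fin g → K} (hc : DifferentiableAt K c a)
    (hs : s =ᶠ[𝓝 a] fun z => limFrame (p ^ e) q g z *ᵥ c z) :
    nablaKZ q i s a = limFrame (p ^ e) q g a *ᵥ covDeriv (p ^ e) q g i c a := by
  rw [nablaKZ, hs.fderiv_eq, hs.eq_of_nhds,
    fderiv_mulVec (analyticAt_limFrame ha hp h).differentiableAt hc, fderiv_limFrame ha hp h hinj,
    covDeriv, Matrix.mulVec_sub, Matrix.mulVec_smul, Matrix.sub_mulVec, Matrix.smul_mulVec,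
    Matrix.mulVec_mulVec, Matrix.mulVec_mulVec]
  abel

end Invariance

section CofactorReduction

open Polynomial

variable {K : Type*} [Field K]

theorem degree_twistedDeriv_X_pow_succ [CharZero K] {F : K[X]} (hF : F.Monic) {q : ℕ}
    (hq : ¬ q ∣ F.natDegree) (m : ℕ) :
    (twistedDeriv F q (X ^ (m + 1))).degree = (m + F.natDegree : ℕ) := by
  obtain ⟨k, hk⟩ : ∃ k, F.natDegree = k + 1 :=
    Nat.exists_eq_succ_of_ne_zero fun h => hq (h ▸ dvd_zero q)
  set G : K[X] := C ((q * (m + 1) : ℕ) : K) * F - derivative F * X with hG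
  have hfactor : twistedDeriv F q (X ^ (m + 1)) = X ^ m * G := by
    rw [twistedDeriv_apply, derivative_X_pow_succ, hG, C_eq_natCast]
    push_cast
    simp only [C_add, C_eq_natCast, C_1]
    ring
  have hcoeff : G.coeff F.natDegree = ((q * (m + 1) : ℕ) : K) - (F.natDegree : ℕ) := by
    rw [hG, coeff_sub, coeff_C_mul, hF.coeff_natDegree, hk, coeff_mul_X, coeff_derivative, ← hk,
      hF.coeff_natDegree, hk]
    push_cast
    ring
  have hlead : G.coeff F.natDegree ≠ 0 := by
    rw [hcoeff, sub_ne_zero, Nat.cast_inj.ne]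
    exact fun h => hq ⟨m + 1, h.symm⟩
  have hle : G.natDegree ≤ F.natDegree := by
    refine (natDegree_sub_le _ _).trans
      (max_le (natDegree_C_mul_le _ _) (natDegree_mul_le.trans ?_))
    have hderivative := natDegree_derivative_le F
    rw [natDegree_X]
    omega
  have hG0 : G ≠ 0 := fun h => hlead (by rw [h, coeff_zero])
  rw [hfactor, degree_mul, degree_X_pow, degree_eq_natDegree hG0,
    natDegree_eq_of_le_of_coeff_ne_zero hle hlead, Nat.cast_add]

theorem degreeLT_sup_range_twistedDeriv [CharZero K] {F : K[X]} (hF : F.Monic) {q : ℕ}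
    (hq : ¬ q ∣ F.natDegree) :
    degreeLT K F.natDegree ⊔ LinearMap.range (twistedDeriv F q) = ⊤ := by
  have hdegree : ∀ d : ℕ, ∃ f ∈ degreeLT K F.natDegree ⊔ LinearMap.range (twistedDeriv F q),
      f.degree = d := by
    intro d
    rcases lt_or_ge d F.natDegree with hd | hd
    · refine ⟨X ^ d, Submodule.mem_sup_left (mem_degreeLT.2 ?_), degree_X_pow d⟩
      rw [degree_X_pow]
      exact_mod_cast hd
    · obtain ⟨m, rfl⟩ := Nat.exists_eq_add_of_le' hd
      exact ⟨_, Submodule.mem_sup_right ⟨_, rfl⟩, degree_twistedDeriv_X_pow_succ hF hq m⟩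
  choose f hf hfd using hdegree
  let S : Polynomial.Sequence K := ⟨f, hfd⟩
  rw [eq_top_iff, ← S.span fun d => (leadingCoeff_ne_zero.2 (S.ne_zero d)).isUnit,
    Submodule.span_le]
  rintro _ ⟨d, rfl⟩
  exact hf d

theorem degreeLT_le_span_cofactorPoly {n : ℕ} {a : Fin n → K} (ha : Function.Injective a) :
    degreeLT K n ≤ Submodule.span K (Set.range (cofactorPoly a)) := by
  intro f hf
  have hdegree : f.degree < Finset.univ.card (α := Fin n) := by
    rw [Finset.card_univ, Fintype.card_fin]
    exact mem_degreeLT.1 hf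
  rw [Lagrange.eq_interpolate ha.injOn hdegree, Lagrange.interpolate_apply]
  refine Submodule.sum_mem _ fun i _ => ?_
  have hbasis : Lagrange.basis Finset.univ a i =
      C (∏ j ∈ Finset.univ.erase i, (a i - a j)⁻¹) * cofactorPoly a i := by
    simp only [Lagrange.basis, Lagrange.basisDivisor, Finset.prod_mul_distrib, cofactorPoly,
      map_prod]
  rw [hbasis, ← smul_eq_C_mul, ← smul_eq_C_mul]
  exact Submodule.smul_mem _ _ (Submodule.smul_mem _ _ (Submodule.subset_span ⟨i, rfl⟩))

theorem exists_eq_sum_cofactorPoly_add_twistedDeriv [CharZero K] {n q : ℕ} (hq : ¬ q ∣ n)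
    {a : Fin n → K} (ha : Function.Injective a) (f : K[X]) :
    ∃ (c : Fin n → K) (r : K[X]),
      f = ∑ i, c i • cofactorPoly a i + twistedDeriv (rootPoly a) q r := by
  have hmonic : (rootPoly a).Monic := monic_prod_of_monic _ _ fun j _ => monic_X_sub_C _
  have hdegree : (rootPoly a).natDegree = n := by
    rw [rootPoly, natDegree_prod_of_monic _ _ fun j _ => monic_X_sub_C _]
    simp
  have hf : f ∈ degreeLT K n ⊔ LinearMap.range (twistedDeriv (rootPoly a) q) := by
    have htop := degreeLT_sup_range_twistedDeriv hmonic (hdegree.symm ▸ hq)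
    rw [hdegree] at htop
    exact htop ▸ Submodule.mem_top
  obtain ⟨f₀, hf₀, _, ⟨r, rfl⟩, rfl⟩ := Submodule.mem_sup.1 hf
  obtain ⟨c, rfl⟩ := (Submodule.mem_span_range_iff_exists_fun K).1
    (degreeLT_le_span_cofactorPoly ha hf₀)
  exact ⟨c, r, rfl⟩

end CofactorReduction

section Rank

open Polynomial
open scoped Matrix

variable {K : Type*} [NontriviallyNormedField K] [IsUltrametricDist K] [CompleteSpace K]
  [CharZero K] {p e q g : ℕ} [Fact p.Prime] {a : Fin (q * g + 1) → K}

theorem exists_vecMul_limFrame_eq_single (hq : 1 < q) (ha : Admissible p e q g)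
    (hp : ‖(p : K)‖ < 1) (h : a ∈ unitDomain K (p ^ e) q g) (hinj : Function.Injective a)
    (u : Fin g) :
    ∃ c : Fin (q * g + 1) → K, c ᵥ* limFrame (p ^ e) q g a = Pi.single u 1 := by
  have hdvd : ¬ q ∣ q * g + 1 := fun h => hq.ne' (Nat.dvd_one.1 ((Nat.dvd_add_right ⟨g, rfl⟩).1 h))
  obtain ⟨c, r, hcr⟩ := exists_eq_sum_cofactorPoly_add_twistedDeriv hdvd hinj
    (X ^ (u : ℕ) * rootPoly a)
  refine ⟨c, ?_⟩
  have hnrow : ∀ᶠ s in atTop, ∑ i, c i • nrowAt (p ^ e) q g s (cofactorPoly MvPolynomial.X i) a +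
      nrow (rootPoly a) (p ^ e) q g s (twistedDeriv (rootPoly a) q r) = Pi.single u 1 := by
    filter_upwards [eventually_ge_atTop 1] with s hs
    have hcomb := nrow_comb (isUnit_det_hwMatrix_of_mem ha hp h hs) (Pi.single u 1)
    rw [comb, Fintype.linearCombination_apply_single, one_smul, hcr, map_add, map_sum] at hcomb
    simpa only [nrowAt, map_smul, map_spec_cofactorPoly] using hcomb
  have hlim := (tendsto_finsetSum Finset.univ fun i _ =>
    (tendsto_nrowAt ha hp h (natDegree_cofactorPoly_X_le i)).const_smul (c i)).add
      (tendsto_nrow_twistedDeriv ha hp h r)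
  rw [add_zero] at hlim
  rw [Matrix.vecMul_eq_sum]
  exact tendsto_nhds_unique (hlim.congr' hnrow) tendsto_const_nhds

theorem exists_mul_limFrame_eq_one (hq : 1 < q) (ha : Admissible p e q g) (hp : ‖(p : K)‖ < 1)
    (h : a ∈ unitDomain K (p ^ e) q g) (hinj : Function.Injective a) :
    ∃ M : Matrix (Fin g) (Fin (q * g + 1)) K, M * limFrame (p ^ e) q g a = 1 := by
  choose M hM using exists_vecMul_limFrame_eq_single hq ha hp h hinj
  refine ⟨Matrix.of M, ?_⟩
  ext1 u w
  rw [Matrix.mul_apply_eq_vecMul, Matrix.one_eq_pi_single]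
  exact congrFun (hM u) w

end Rank

section Translation

theorem ord_pos {p q : ℕ} (hpq : p.Coprime q) (hq : 0 < q) : 0 < ord p q := by
  have : NeZero q := ⟨hq.ne'⟩
  rw [ord, ← ZMod.coe_unitOfCoprime p hpq, orderOf_units]
  exact orderOf_pos _

theorem dvd_pow_ord_sub_one {p : ℕ} (hp : 0 < p) (q : ℕ) : q ∣ p ^ ord p q - 1 := by
  refine (Nat.modEq_iff_dvd' (Nat.one_le_pow _ _ hp)).1 ((ZMod.natCast_eq_natCast_iff _ _ _).1 ?_)
  rw [Nat.cast_pow, Nat.cast_one]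
  exact (pow_orderOf_eq_one _).symm

variable {p q g : ℕ}

open scoped Matrix

variable {K : Type*} [NontriviallyNormedField K] {a : Fin (q * g + 1) → K}

theorem mem_fiberL_iff {v : Fin (q * g + 1) → K} :
    v ∈ fiberL K p q g a ↔ ∃ c : Fin g → K, v = frame K p q g a *ᵥ c := by
  rw [fiberL, Submodule.mem_span_range_iff_exists_fun]
  refine exists_congr fun c => ?_
  rw [Matrix.mulVec_eq_sum, eq_comm]
  simp only [op_smul_eq_smul]
  rfl

theorem injective_of_mem_domainKZo (h : a ∈ domainKZo K p q g) : Function.Injective a :=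
  fun i j hij => by_contra fun hne => h.2 i j hne hij

variable [Fact p.Prime]

theorem admissible_ord (hpq : p.Coprime q) (hq : 0 < q) (hg : g < p ^ ord p q) :
    Admissible p (ord p q) q g :=
  ⟨ord_pos hpq hq, dvd_pow_ord_sub_one (Fact.out : p.Prime).pos q, hg⟩

theorem hasseWittAt_eq (ha : Admissible p (ord p q) q g) {s : ℕ} (hs : 1 ≤ s)
    (a : Fin (q * g + 1) → K) :
    hasseWittAt K p q g s a = hwMatrix (rootPoly a) (p ^ ord p q) q g s := by
  rw [hasseWittAt, hasseWitt_eq (expo_pos ha.one_lt ha.dvd hs)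
    (ha.lt.trans_le (Nat.le_self_pow (Nat.ne_of_gt hs) _)), ← map_spec_rootPoly a, hwMatrix_map]
  rfl

theorem hypSolAt_apply (ha : Admissible p (ord p q) q g) {s : ℕ} (hs : 1 ≤ s)
    (a : Fin (q * g + 1) → K) (i : Fin (q * g + 1)) : hypSolAt K p q g s a i =
      row (rootPoly a) (p ^ ord p q) q g s (cofactorPoly a i) := by
  rw [← map_spec_cofactorPoly, ← spec_comp_row]
  ext l
  rw [hypSolAt, Matrix.map_apply, hypSol_apply (expo_pos ha.one_lt ha.dvd hs)]
  rfl

theorem approxFrame_apply (ha : Admissible p (ord p q) q g) {s : ℕ} (hs : 1 ≤ s)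
    (a : Fin (q * g + 1) → K) (i : Fin (q * g + 1)) : approxFrame K p q g s a i =
      nrowAt (p ^ ord p q) q g s (cofactorPoly MvPolynomial.X i) a := by
  ext l
  rw [approxFrame, Matrix.mul_apply_eq_vecMul, hasseWittAt_eq ha hs, hypSolAt_apply ha hs, nrowAt,
    nrow_eq_vecMul, map_spec_cofactorPoly]

theorem domainKZ_eq (ha : Admissible p (ord p q) q g) :
    domainKZ K p q g = unitDomain K (p ^ ord p q) q g := by
  simp only [domainKZ, unitDomain, hasseWittAt_eq ha le_rfl]

theorem frame_eq [IsUltrametricDist K] [CompleteSpace K] (ha : Admissible p (ord p q) q g)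
    (hp : ‖(p : K)‖ < 1) (h : a ∈ domainKZ K p q g) :
    frame K p q g a = limFrame (p ^ ord p q) q g a := by
  rw [domainKZ_eq ha] at h
  ext i l
  refine (((tendsto_pi_nhds.1 (tendsto_nrowAt ha hp h (natDegree_cofactorPoly_X_le i)) l).congr'
    ?_).limUnder_eq :)
  filter_upwards [eventually_ge_atTop 1] with s hs
  rw [approxFrame_apply ha hs]

end Translation

section FiberW

variable (K : Type*) [NontriviallyNormedField K]

theorem finrank_fiberW (n : ℕ) : Module.finrank K (fiberW K (n + 1)) = n := by
  let φ : Module.Dual K (Fin (n + 1) → K) := ∑ i, LinearMap.proj i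
  have hφ (v : Fin (n + 1) → K) : φ v = ∑ i, v i := by
    rw [LinearMap.sum_apply]
    rfl
  have hφ0 : φ ≠ 0 := fun h => by simpa [h] using hφ (Pi.single 0 1)
  have hker : fiberW K (n + 1) = LinearMap.ker φ := by
    ext v
    rw [LinearMap.mem_ker, hφ]
    rfl
  have hfinrank := Module.Dual.finrank_ker_add_one_of_ne_zero hφ0
  rw [Module.finrank_fin_fun, Nat.add_right_cancel_iff] at hfinrank
  rw [hker, hfinrank]

end FiberW

section Sections

open scoped Matrix

variable {K : Type*} [NontriviallyNormedField K] [IsUltrametricDist K]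
  {p q g : ℕ} [Fact p.Prime] {a : Fin (q * g + 1) → K} {U : Set (Fin (q * g + 1) → K)}

theorem norm_det_hasseWittAt_eq_one (ha : Admissible p (ord p q) q g) (hp : ‖(p : K)‖ < 1)
    (h : a ∈ domainKZ K p q g) {s : ℕ} (hs : 1 ≤ s) : ‖(hasseWittAt K p q g s a).det‖ = 1 := by
  rw [domainKZ_eq ha] at h
  rw [hasseWittAt_eq ha hs, norm_det_hwMatrix_eq_one ha hp h hs]

variable [CompleteSpace K]

theorem tendstoUniformlyOn_approxFrame (ha : Admissible p (ord p q) q g) (hp : ‖(p : K)‖ < 1)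
    (i : Fin (q * g + 1)) (l : Fin g) :
    TendstoUniformlyOn (fun (s : ℕ) a => approxFrame K p q g s a i l)
      (fun a => frame K p q g a i l) atTop (domainKZ K p q g) := by
  have hlim := (Pi.uniformContinuous_proj (fun _ : Fin g => K) l).comp_tendstoUniformlyOn
    (tendstoUniformlyOn_nrowAt ha hp (natDegree_cofactorPoly_X_le i))
  rw [← domainKZ_eq ha] at hlim
  refine (hlim.congr_right fun a h => ?_).congr ?_
  · rw [frame_eq ha hp h]
    rfl
  · filter_upwards [eventually_ge_atTop 1] with s hs a _
    exact (congrFun (approxFrame_apply ha hs a i) l).symm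

theorem analyticOnNhd_frame (ha : Admissible p (ord p q) q g) (hp : ‖(p : K)‖ < 1)
    (i : Fin (q * g + 1)) (l : Fin g) :
    AnalyticOnNhd K (fun a => frame K p q g a i l) (domainKZ K p q g) := by
  intro a h
  rw [domainKZ_eq ha] at h
  refine (analyticAt_pi_iff.1 (analyticAt_pi_iff.1 (analyticAt_limFrame ha hp h) i) l).congr ?_
  filter_upwards [eventually_mem_unitDomain h] with z hz
  rw [frame_eq ha hp ((domainKZ_eq ha).superset hz)]

theorem fiberL_le_fiberW (ha : Admissible p (ord p q) q g) (hp : ‖(p : K)‖ < 1)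
    (h : a ∈ domainKZ K p q g) : fiberL K p q g a ≤ fiberW K (q * g + 1) := by
  rw [fiberL, Submodule.span_le, frame_eq ha hp h]
  rintro _ ⟨l, rfl⟩
  have hsum := congrFun (sum_limRow_cofactorPoly ha hp ((domainKZ_eq ha).subset h)) l
  rwa [Finset.sum_apply] at hsum

variable [CharZero K]

theorem exists_mul_frame_eq_one (hq : 1 < q) (ha : Admissible p (ord p q) q g)
    (hp : ‖(p : K)‖ < 1) (h : a ∈ domainKZo K p q g) :
    ∃ M : Matrix (Fin g) (Fin (q * g + 1)) K, M * frame K p q g a = 1 := by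
  rw [frame_eq ha hp h.1]
  exact exists_mul_limFrame_eq_one hq ha hp ((domainKZ_eq ha).subset h.1)
    (injective_of_mem_domainKZo h)

theorem finrank_fiberL (hq : 1 < q) (ha : Admissible p (ord p q) q g) (hp : ‖(p : K)‖ < 1)
    (h : a ∈ domainKZo K p q g) : Module.finrank K (fiberL K p q g a) = g := by
  obtain ⟨M, hM⟩ := exists_mul_frame_eq_one hq ha hp h
  have hinj : Function.Injective (frame K p q g a).mulVec := Function.LeftInverse.injective
    (g := M.mulVec) fun v => by rw [Matrix.mulVec_mulVec, hM, Matrix.one_mulVec]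
  have hli : LinearIndependent K fun l : Fin g => fun i => frame K p q g a i l :=
    Matrix.mulVec_injective_iff.1 hinj
  rw [fiberL, finrank_span_eq_card hli, Fintype.card_fin]

theorem isFrameSection_nablaKZ (ha : Admissible p (ord p q) q g) (hp : ‖(p : K)‖ < 1)
    (hU : IsOpen U) (hUD : U ⊆ domainKZ K p q g)
    {s : (Fin (q * g + 1) → K) → Fin (q * g + 1) → K} (hs : IsFrameSection p q g U s)
    (i : Fin (q * g + 1)) : ∃ s', IsFrameSection p q g U s' ∧
      ∀ z ∈ U ∩ domainKZo K p q g, nablaKZ q i s z = s' z := by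
  obtain ⟨c, hc, hsc⟩ := hs
  have hunit : U ⊆ unitDomain K (p ^ ord p q) q g := hUD.trans (domainKZ_eq ha).subset
  refine ⟨fun z => frame K p q g z *ᵥ covDeriv (p ^ ord p q) q g i c z,
    ⟨_, fun z hz => analyticAt_covDeriv ha hp (hunit hz) i (hc z hz), fun _ _ => rfl⟩, ?_⟩
  rintro z ⟨hz, hzo⟩
  have hs : s =ᶠ[𝓝 z] fun x => limFrame (p ^ ord p q) q g x *ᵥ c x := by
    filter_upwards [hU.mem_nhds hz] with x hx
    rw [hsc x hx, frame_eq ha hp (hUD hx)]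
  beta_reduce
  rw [frame_eq ha hp (hUD hz)]
  exact nablaKZ_eq ha hp (hunit hz) (injective_of_mem_domainKZo hzo) i (hc z hz).differentiableAt hs

theorem exists_analyticAt_eventuallyEq_limFrame_mulVec (hq : 1 < q)
    (ha : Admissible p (ord p q) q g) (hp : ‖(p : K)‖ < 1) (hU : IsOpen U)
    (hUD : U ⊆ domainKZo K p q g) {s : (Fin (q * g + 1) → K) → Fin (q * g + 1) → K}
    (hs : IsFiberSection p q g U s) (haU : a ∈ U) :
    ∃ c : (Fin (q * g + 1) → K) → Fin g → K,
      AnalyticAt K c a ∧ s =ᶠ[𝓝 a] fun z => limFrame (p ^ ord p q) q g z *ᵥ c z := by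
  obtain ⟨M, hM⟩ := exists_mul_frame_eq_one hq ha hp (hUD haU)
  rw [frame_eq ha hp (hUD haU).1] at hM
  refine exists_analyticAt_eventuallyEq_mulVec
    (analyticAt_limFrame ha hp ((domainKZ_eq ha).subset (hUD haU).1)) hM (hs.1 a haU) ?_
  filter_upwards [hU.mem_nhds haU] with z hz
  rw [← frame_eq ha hp (hUD hz).1]
  exact mem_fiberL_iff.1 (hs.2 z hz)

theorem isFiberSection_nablaKZ (hq : 1 < q) (ha : Admissible p (ord p q) q g)
    (hp : ‖(p : K)‖ < 1) (hU : IsOpen U) (hUD : U ⊆ domainKZo K p q g)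
    {s : (Fin (q * g + 1) → K) → Fin (q * g + 1) → K} (hs : IsFiberSection p q g U s)
    (i : Fin (q * g + 1)) : IsFiberSection p q g U (nablaKZ q i s) := by
  have hunit : U ⊆ unitDomain K (p ^ ord p q) q g := fun z hz =>
    (domainKZ_eq ha).subset (hUD hz).1
  have hinj {z} (hz : z ∈ U) : Function.Injective z := injective_of_mem_domainKZo (hUD hz)
  refine ⟨fun a haU => ?_, fun a haU => ?_⟩ <;>
    obtain ⟨c, hc, hsc⟩ := exists_analyticAt_eventuallyEq_limFrame_mulVec hq ha hp hU hUD hs haU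
  · refine (analyticAt_mulVec (analyticAt_limFrame ha hp (hunit haU))
      (analyticAt_covDeriv ha hp (hunit haU) i hc)).congr ?_
    filter_upwards [hU.mem_nhds haU, hc.eventually_analyticAt, hsc.eventuallyEq_nhds]
      with z hz hcz hscz
    exact (nablaKZ_eq ha hp (hunit hz) (hinj hz) i hcz.differentiableAt hscz).symm
  · rw [nablaKZ_eq ha hp (hunit haU) (hinj haU) i hc.differentiableAt hsc,
      ← frame_eq ha hp (hUD haU).1]
    exact mem_fiberL_iff.2 ⟨_, rfl⟩

end Sections

section Unramified

variable (p : ℕ) [Fact p.Prime] (m : ℕ)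

instance : IsUltrametricDist (Qpm p m) :=
  inferInstanceAs (IsUltrametricDist (unramified p m))

instance : CharZero (Qpm p m) :=
  inferInstanceAs (CharZero (unramified p m))

theorem norm_natCast_Qpm_lt_one : ‖(p : Qpm p m)‖ < 1 := by
  have hnorm : ‖(p : Qpm p m)‖ = ‖((p : unramified p m) : PadicAlgCl p)‖ := rfl
  have hcast : ((p : unramified p m) : PadicAlgCl p) = algebraMap ℚ_[p] (PadicAlgCl p) p := by simp
  rw [hnorm, hcast, PadicAlgCl.norm_extends]
  exact Padic.norm_p_lt_one

variable {m}

theorem finiteDimensional_unramified (hm : 0 < m) :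
    FiniteDimensional ℚ_[p] (unramified p m) := by
  have hpos : 0 < p ^ m - 1 := Nat.sub_pos_of_lt (Nat.one_lt_pow hm.ne' (Fact.out : p.Prime).one_lt)
  have hroots : {ζ : PadicAlgCl p | ζ ^ (p ^ m - 1) = 1}.Finite := by
    classical
    refine (Polynomial.nthRootsFinset (p ^ m - 1) (1 : PadicAlgCl p)).finite_toSet.subset ?_
    exact fun ζ hζ => (Polynomial.mem_nthRootsFinset hpos _).2 hζ
  have := hroots.to_subtype
  exact IntermediateField.finiteDimensional_adjoin fun x _ => Algebra.IsIntegral.isIntegral x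

theorem completeSpace_Qpm (hm : 0 < m) : CompleteSpace (Qpm p m) :=
  have := finiteDimensional_unramified p hm
  FiniteDimensional.complete ℚ_[p] (unramified p m)

end Unramified

end PadicKZ

end

open PadicKZ in
theorem mainTheorem2_general (K : Type*) [NontriviallyNormedField K] [IsUltrametricDist K]
    [CompleteSpace K] [CharZero K] (p q g : ℕ) [Fact p.Prime] (hp : ‖(p : K)‖ < 1) (hq : 1 < q)
    (hpq : p.Coprime q) (hg : g < p ^ ord p q) :
    (∀ s : ℕ, 1 ≤ s → ∀ a ∈ domainKZ K p q g, ‖(hasseWittAt K p q g s a).det‖ = 1) ∧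
    (∀ i l, TendstoUniformlyOn (fun (s : ℕ) a => approxFrame K p q g s a i l)
      (fun a => frame K p q g a i l) Filter.atTop (domainKZ K p q g)) ∧
    (∀ i l, AnalyticOnNhd K (fun a => frame K p q g a i l) (domainKZ K p q g)) ∧
    (Module.finrank K (fiberW K (q * g + 1)) = q * g ∧
      ∀ a ∈ domainKZ K p q g, fiberL K p q g a ≤ fiberW K (q * g + 1)) ∧
    (∀ U : Set (Fin (q * g + 1) → K), IsOpen U → U ⊆ domainKZ K p q g →
      ∀ s, IsFrameSection p q g U s → ∀ i, ∃ s', IsFrameSection p q g U s' ∧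
        ∀ z ∈ U ∩ domainKZo K p q g, nablaKZ q i s z = s' z) ∧
    (∀ U : Set (Fin (q * g + 1) → K), IsOpen U → U ⊆ domainKZo K p q g →
      ∀ s, IsFiberSection p q g U s → ∀ i, IsFiberSection p q g U (nablaKZ q i s)) ∧
    (∀ a ∈ domainKZo K p q g, Module.finrank K (fiberL K p q g a) = g) := by
  have ha := admissible_ord hpq (zero_lt_one.trans hq) hg
  exact ⟨fun _ hs _ h => norm_det_hasseWittAt_eq_one ha hp h hs,
    tendstoUniformlyOn_approxFrame ha hp,
    analyticOnNhd_frame ha hp,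
    ⟨finrank_fiberW K _, fun _ h => fiberL_le_fiberW ha hp h⟩,
    fun _ hU hUD _ hs => isFrameSection_nablaKZ ha hp hU hUD hs,
    fun _ hU hUD _ hs => isFiberSection_nablaKZ hq ha hp hU hUD hs,
    fun _ h => finrank_fiberL hq ha hp h⟩

theorem mainTheorem2 (p q g m : ℕ) [Fact p.Prime] (hq : q.Prime) (hqp : q < p)
    (hg : 0 < g) (hm : 0 < m)
    (hpe : q * g + 1 < p ^ PadicKZ.ord p q)
    (hp : (q * g + 1) + q - 2 ≤ p) :
    -- the matrices `A(Φ_s(t, a))` are invertible on the domain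
    (∀ s : ℕ, 1 ≤ s → ∀ a ∈ PadicKZ.domainKZ (PadicKZ.Qpm p m) p q g,
      ‖(PadicKZ.hasseWittAt (PadicKZ.Qpm p m) p q g s a).det‖ = 1) ∧
    -- `𝓘` is a uniform limit on the domain, and is analytic there
    (∀ i l, TendstoUniformlyOn
      (fun (s : ℕ) a => PadicKZ.approxFrame (PadicKZ.Qpm p m) p q g s a i l)
      (fun a => PadicKZ.frame (PadicKZ.Qpm p m) p q g a i l) Filter.atTop
      (PadicKZ.domainKZ (PadicKZ.Qpm p m) p q g)) ∧
    (∀ i l, AnalyticOnNhd (PadicKZ.Qpm p m)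
      (fun a => PadicKZ.frame (PadicKZ.Qpm p m) p q g a i l)
      (PadicKZ.domainKZ (PadicKZ.Qpm p m) p q g)) ∧
    -- `𝓛` is a distribution in the fibers of the KZ bundle, which have dimension `q g`
    (Module.finrank (PadicKZ.Qpm p m) (PadicKZ.fiberW (PadicKZ.Qpm p m) (q * g + 1)) = q * g ∧
      ∀ a ∈ PadicKZ.domainKZ (PadicKZ.Qpm p m) p q g,
        PadicKZ.fiberL (PadicKZ.Qpm p m) p q g a ≤
          PadicKZ.fiberW (PadicKZ.Qpm p m) (q * g + 1)) ∧
    -- invariance over the whole domain: the image of a section is, off the diagonals,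
    -- the restriction of a section
    (∀ U : Set (Fin (q * g + 1) → PadicKZ.Qpm p m), IsOpen U →
      U ⊆ PadicKZ.domainKZ (PadicKZ.Qpm p m) p q g →
      ∀ s, PadicKZ.IsFrameSection p q g U s → ∀ i,
        ∃ s', PadicKZ.IsFrameSection p q g U s' ∧
          ∀ z ∈ U ∩ PadicKZ.domainKZo (PadicKZ.Qpm p m) p q g,
            PadicKZ.nablaKZ q i s z = s' z) ∧
    -- invariance off the diagonals, for sections in the fiberwise sense
    (∀ U : Set (Fin (q * g + 1) → PadicKZ.Qpm p m), IsOpen U →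
      U ⊆ PadicKZ.domainKZo (PadicKZ.Qpm p m) p q g →
      ∀ s, PadicKZ.IsFiberSection p q g U s → ∀ i,
        PadicKZ.IsFiberSection p q g U (PadicKZ.nablaKZ q i s)) ∧
    -- the rank of the invariant subbundle
    (PadicKZ.dPhi p q g + PadicKZ.dM p q g < p ^ m →
      ∀ a ∈ PadicKZ.domainKZo (PadicKZ.Qpm p m) p q g,
        Module.finrank (PadicKZ.Qpm p m) (PadicKZ.fiberL (PadicKZ.Qpm p m) p q g a) = g) := by
  have := PadicKZ.completeSpace_Qpm p hm
  have hpq : p.Coprime q := (Nat.coprime_primes Fact.out hq).2 hqp.ne'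
  have hgp : g < p ^ PadicKZ.ord p q :=
    (Nat.le_mul_of_pos_left g hq.pos).trans_lt ((Nat.lt_succ_self _).trans hpe)
  obtain ⟨hdet, hlim, hanalytic, hW, hframe, hfiber, hrank⟩ := mainTheorem2_general
    (PadicKZ.Qpm p m) p q g (PadicKZ.norm_natCast_Qpm_lt_one p m) hq.one_lt hpq hgp
  exact ⟨hdet, hlim, hanalytic, hW, hframe, hfiber, fun _ => hrank⟩
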